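/- Fix $n,m\in\mathbb N$. Let $g:\mathbb R^n\to\mathbb R^{n\times m}$ be locally Lipschitz with $\lambda_{\min}\|z\|^2\le z^Tg(y)g(y)^Tz$ for all $y,z\in\mathbb R^n$ and some $\lambda_{\min}>0$. **Formulas.** Non-temporal formulas are $\psi::=\top\mid\mu\mid\neg\mu\mid\psi_1\wedge\psi_2$, where a predicate $\mu$ is given by a continuously differentiable $h:\mathbb R^n\to\mathbb R$ and holds at $y$ iff $h(y)\ge0$. Their (smoothed) robustness, for a fixed $\eta>0$, is $\rho^\top=+\infty$, $\rho^\mu=h$, $\rho^{\neg\mu}=-h$ and $\rho^{\psi_1\wedge\psi_2}=-\frac1\eta\ln\big(e^{-\eta\rho^{\psi_1}}+e^{-\eta\rho^{\psi_2}}\big)$ (with $e^{-\infty}=0$, $\ln 0=-\infty$). Let $\phi=G_{[a,b]}\psi$ or $\phi=F_{[a,b]}\psi$ with $0\le a\le b\le\infty$, $a<\infty$. For a signal $x:[0,\infty)\to\mathbb R^n$, $(x,0)\models G_{[a,b]}\psi$ (resp. $F_{[a,b]}\psi$) means that $\psi$ holds at $x(t)$ for all (resp. some) real $t\in[a,b]$,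 and $\rho^\phi(x,0)$ is the infimum (resp. supremum) of $\rho^\psi(x(t))$ over real $t\in[a,b]$. Assume that $\rho^\psi$ is concave, that for some $C\ge 0$ one has $\|y\|\le C$ whenever $\rho^\psi(y)>0$, and that $\rho_{opt}:=\sup_{y}\rho^\psi(y)>0$. **Parameters.** Let $x_0\in\mathbb R^n$ and $\rho_0:=\rho^\psi(x_0)$. Choose $t_*=a$ if $\phi=G_{[a,b]}\psi$, and a real $t_*\in[a,b]$ if $\phi=F_{[a,b]}\psi$; $0<\chi<\rho_{opt}-\max(0,\rho_0)$; $\rho_{max}\in(\max(0,\rho_0),\rho_{opt}-\chi]$; $r\in(0,\rho_{max})$, with $r<\rho_0$ if $t_*=0$; $\gamma_0>\rho_{max}-\rho_0$, with moreover $\gamma_0\le\rho_{max}-r$ if $t_*=0$; $\gamma_\infty\in(0,\min(\gamma_0,\rho_{max}-r)]$; and $l\ge0$ arbitrary if $\rho_{max}-\gamma_0\ge r$, while if $\rho_{max}-\gamma_0<r$ then $\gamma_\infty<\rho_{max}-r$ and $$l=-\frac1{t_*}\ln\frac{r+\gamma_\infty-\rho_{max}}{-(\gamma_0-\gamma_\infty)}.$$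 Put $\gamma(t)=(\gamma_0-\gamma_\infty)e^{-lt}+\gamma_\infty$, $\xi(y,t)=\frac{\rho^\psi(y)-\rho_{max}}{\gamma(t)}$, $\Omega=\{(y,t): t\ge0,\ -1<\xi(y,t)<0\}$, $\epsilon(y,t)=\ln\big(-\frac{\xi(y,t)+1}{\xi(y,t)}\big)$ and $$u(y,t)=-\epsilon(y,t)\,g(y)^T\frac{\partial\rho^\psi}{\partial x}(y).$$ **Claim.** For every $\delta_u>0$ there is a function $\delta:\mathbb R^n\times[0,\infty)\to(0,\infty)$, depending only on the data introduced so far, such that the following two statements hold. 1. If $(y,t)\in\Omega$, $\|y'-y\|_\infty\le\delta(y,t)$ and $t\le t'\le t+\delta(y,t)$, then $(y',t')\in\Omega$ and $\|u(y',t')-u(y,t)\|_\infty\le\delta_u$. 2. Let $f:\mathbb R^n\to\mathbb R^n$ be any locally Lipschitz function and $w:[0,\infty)\to\mathcal W$ any piecewise continuous function with values in a bounded set $\mathcal W\subset\mathbb R^n$. Consider the system $\dot x=f(x)+g(x)\hat u+w(t)$, $x(0)=x_0$, with the zero-order-hold control $\hat u(t)=u(x(t_i),t_i)$ for $t\in[t_i,t_{i+1})$,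 where $t_0=0$, $\delta_i=\delta(x(t_i),t_i)$ and $$t_{i+1}=\inf\{t>t_i:\ \|x(t)-x(t_i)\|_\infty>\delta_i\ \text{ or }\ t-t_i>\delta_i\};$$ in this infimum $x(t)$ is the solution that continues from $(t_i,x(t_i))$ with the held input $u(x(t_i),t_i)$. This closed loop has a solution $x$ on all of $[0,\infty)$ with $t_i$ strictly increasing to $\infty$ (no Zeno behaviour), and every such solution satisfies $0<r\le\rho^\phi(x,0)\le\rho_{max}$ and $(x,0)\models\phi$. -/

import Mathlib

open scoped Matrix

noncomputable section

/-- A predicate, given by a continuously differentiable predicate function `h : ℝⁿ → ℝ`. -/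
structure STLPredicate (n : ℕ) where
  h : (Fin n → ℝ) → ℝ
  contDiff_h : ContDiff ℝ 1 h

/-- Non-temporal formulas `ψ ::= ⊤ | μ | ¬μ | ψ₁ ∧ ψ₂`. -/
inductive NonTemporalFormula (n : ℕ) where
  | top : NonTemporalFormula n
  | pred (μ : STLPredicate n) : NonTemporalFormula n
  | negPred (μ : STLPredicate n) : NonTemporalFormula n
  | conj (ψ₁ ψ₂ : NonTemporalFormula n) : NonTemporalFormula n

namespace NonTemporalFormula

variable {n : ℕ}

/-- Boolean semantics of a non-temporal formula at the state `y`. -/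
def Sat : NonTemporalFormula n → (Fin n → ℝ) → Prop
  | top, _ => True
  | pred μ, y => 0 ≤ μ.h y
  | negPred μ, y => ¬ 0 ≤ μ.h y
  | conj ψ₁ ψ₂, y => ψ₁.Sat y ∧ ψ₂.Sat y

/-- Smoothed robust semantics `ρ^ψ(y)`, with `ρ^⊤ = +∞` and
`ρ^{ψ₁ ∧ ψ₂} = -(1/η) ln (exp (-η ρ^{ψ₁}) + exp (-η ρ^{ψ₂}))`, where `exp (-∞) = 0` and
`ln 0 = -∞`. It is real valued except for conjunctions of copies of `⊤`, where it is `+∞`. -/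
def rho (η : ℝ) : NonTemporalFormula n → (Fin n → ℝ) → EReal
  | top, _ => ⊤
  | pred μ, y => ((μ.h y : ℝ) : EReal)
  | negPred μ, y => ((-μ.h y : ℝ) : EReal)
  | conj ψ₁ ψ₂, y =>
      ((-(1 / η) : ℝ) : EReal) *
        ENNReal.log (EReal.exp (((-η : ℝ) : EReal) * ψ₁.rho η y)
          + EReal.exp (((-η : ℝ) : EReal) * ψ₂.rho η y))

/-- `ρ^ψ` as a real function of the state. -/
def rhoReal (η : ℝ) (ψ : NonTemporalFormula n) (y : Fin n → ℝ) : ℝ := (ψ.rho η y).toReal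

/-- The global optimum `sup_y ρ^ψ(y)`. -/
def rhoOpt (η : ℝ) (ψ : NonTemporalFormula n) : EReal := ⨆ y, ψ.rho η y

/-- The column vector `∂ρ^ψ/∂x` of partial derivatives at `y`. -/
def gradRho (η : ℝ) (ψ : NonTemporalFormula n) (y : Fin n → ℝ) : Fin n → ℝ :=
  fun i => fderiv ℝ (ψ.rhoReal η) y (Pi.single i 1)

/-- Well-posedness: `ρ^ψ(y) > 0` implies that the Euclidean norm of `y` is at most `C < ∞`. -/
def WellPosed (η : ℝ) (ψ : NonTemporalFormula n) : Prop :=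
  ∃ C : ℝ, 0 ≤ C ∧ ∀ y, 0 < ψ.rho η y → √(y ⬝ᵥ y) ≤ C

end NonTemporalFormula

/-- A time window `[a, b]` with `0 ≤ a ≤ b`, `a` real and `b` real or `+∞`. -/
structure TimeWindow where
  a : ℝ
  b : EReal
  a_nonneg : 0 ≤ a
  a_le_b : (a : EReal) ≤ b

/-- The real times in `[t + a, t + b]`. -/
def TimeWindow.shift (I : TimeWindow) (t : ℝ) : Set ℝ :=
  {t₁ | t + I.a ≤ t₁ ∧ (t₁ : EReal) ≤ (t : EReal) + I.b}

/-- Temporal formulas `φ ::= G_{[a,b]} ψ | F_{[a,b]} ψ`. -/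
inductive TemporalFormula (n : ℕ) where
  | always (I : TimeWindow) (ψ : NonTemporalFormula n) : TemporalFormula n
  | eventually (I : TimeWindow) (ψ : NonTemporalFormula n) : TemporalFormula n

namespace TemporalFormula

variable {n : ℕ}

/-- The non-temporal formula `ψ` inside `φ`. -/
def inner : TemporalFormula n → NonTemporalFormula n
  | always _ ψ => ψ
  | eventually _ ψ => ψ

/-- The satisfaction relation `(x, t) ⊨ φ`. -/
def Sat : TemporalFormula n → (ℝ → Fin n → ℝ) → ℝ → Prop
  | always I ψ, x, t => ∀ t₁ ∈ I.shift t, ψ.Sat (x t₁)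
  | eventually I ψ, x, t => ∃ t₁ ∈ I.shift t, ψ.Sat (x t₁)

/-- Robust semantics `ρ^φ(x, t)`; minimum and maximum are read as infimum and supremum, which are
attained for continuous `x` and bounded windows. -/
def rho (η : ℝ) : TemporalFormula n → (ℝ → Fin n → ℝ) → ℝ → EReal
  | always I ψ, x, t => ⨅ t₁ ∈ I.shift t, ψ.rho η (x t₁)
  | eventually I ψ, x, t => ⨆ t₁ ∈ I.shift t, ψ.rho η (x t₁)

/-- The admissible times `t⋆`: `t⋆ = a` for `G_{[a,b]} ψ` and `t⋆ ∈ [a,b]` for `F_{[a,b]} ψ`. -/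
def IsTargetTime : TemporalFormula n → ℝ → Prop
  | always I _, t => t = I.a
  | eventually I _, t => t ∈ I.shift 0

end TemporalFormula

/-- The parameters of prescribed performance control. -/
structure PPCParams where
  tstar : ℝ
  χ : ℝ
  ρmax : ℝ
  r : ℝ
  γ₀ : ℝ
  γinf : ℝ
  l : ℝ

/-- The performance function `γ(t) = (γ₀ - γ_∞) exp(-l t) + γ_∞`. -/
def PPCParams.gamma (p : PPCParams) (t : ℝ) : ℝ :=
  (p.γ₀ - p.γinf) * Real.exp (-p.l * t) + p.γinf

/-- The rules by which the parameters are chosen for the formula `φ` and the initial state `x₀`.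
The first part of `l_of_lt` says that the logarithm in the second part is defined. -/
structure IsPPCChoice {n : ℕ} (η : ℝ) (φ : TemporalFormula n) (x₀ : Fin n → ℝ)
    (p : PPCParams) : Prop where
  tstar_mem : φ.IsTargetTime p.tstar
  χ_pos : 0 < p.χ
  χ_lt : (p.χ : EReal) < φ.inner.rhoOpt η - max 0 (φ.inner.rho η x₀)
  lt_ρmax : max 0 (φ.inner.rho η x₀) < (p.ρmax : EReal)
  ρmax_le : (p.ρmax : EReal) ≤ φ.inner.rhoOpt η - (p.χ : EReal)
  r_pos : 0 < p.r
  r_lt : p.r < p.ρmax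
  lt_rho_of_tstar_eq_zero : p.tstar = 0 → p.r < φ.inner.rhoReal η x₀
  lt_γ₀ : p.ρmax - φ.inner.rhoReal η x₀ < p.γ₀
  γ₀_le_of_tstar_eq_zero : p.tstar = 0 → p.γ₀ ≤ p.ρmax - p.r
  γinf_pos : 0 < p.γinf
  γinf_le : p.γinf ≤ min p.γ₀ (p.ρmax - p.r)
  l_of_le : p.r ≤ -p.γ₀ + p.ρmax → 0 ≤ p.l
  l_of_lt : -p.γ₀ + p.ρmax < p.r →
    0 < (p.r + p.γinf - p.ρmax) / (-(p.γ₀ - p.γinf)) ∧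
    p.l = Real.log ((p.r + p.γinf - p.ρmax) / (-(p.γ₀ - p.γinf))) / (-p.tstar)

/-- The transformation function `S(ξ) = ln (-(ξ + 1) / (ξ - M))` on `(-1, M)`. -/
def transformation (M ξ : ℝ) : ℝ := Real.log (-((ξ + 1) / (ξ - M)))

section Control

variable {n m : ℕ}

/-- The normalized error `ξ(y, t) = (ρ^ψ(y) - ρ_max) / γ(t)`. -/
def normalizedError (η : ℝ) (ψ : NonTemporalFormula n) (p : PPCParams)
    (y : Fin n → ℝ) (t : ℝ) : ℝ :=
  (ψ.rhoReal η y - p.ρmax) / p.gamma t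

/-- The transformed error `ε(y, t) = S(ξ(y, t))`, with `M = 0`. -/
def transformedError (η : ℝ) (ψ : NonTemporalFormula n) (p : PPCParams)
    (y : Fin n → ℝ) (t : ℝ) : ℝ :=
  transformation 0 (normalizedError η ψ p y t)

/-- The domain `Ω = {(y, t) | t ≥ 0, -1 < ξ(y, t) < 0}` of the control law. -/
def InFunnel (η : ℝ) (ψ : NonTemporalFormula n) (p : PPCParams)
    (y : Fin n → ℝ) (t : ℝ) : Prop :=
  0 ≤ t ∧ normalizedError η ψ p y t ∈ Set.Ioo (-1 : ℝ) 0

/-- The control law `u(y, t) = -ε(y, t) g(y)ᵀ ∂ρ^ψ/∂x`. -/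
def controlLaw (g : (Fin n → ℝ) → Matrix (Fin n) (Fin m) ℝ) (η : ℝ)
    (ψ : NonTemporalFormula n) (p : PPCParams) (y : Fin n → ℝ) (t : ℝ) : Fin m → ℝ :=
  -(transformedError η ψ p y t • ((g y)ᵀ *ᵥ ψ.gradRho η y))

/-- `w` is piecewise continuous on `[0, ∞)`: finitely many discontinuities in every bounded
interval, each of them with one-sided limits. -/
structure PiecewiseContinuous (w : ℝ → Fin n → ℝ) : Prop where
  finite_discontinuities : ∀ T : ℝ,
    {t | t ∈ Set.Icc 0 T ∧ ¬ ContinuousWithinAt w (Set.Ici 0) t}.Finite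
  right_limit : ∀ t : ℝ, 0 ≤ t → ∃ y, Filter.Tendsto w (nhdsWithin t (Set.Ioi t)) (nhds y)
  left_limit : ∀ t : ℝ, 0 < t → ∃ y, Filter.Tendsto w (nhdsWithin t (Set.Iio t)) (nhds y)

/-- `z` solves `ż = f(z) + g(z) v + w` on `[s, σ)` for the input signal `v`, in the sense of the
integral equation. -/
structure IsTrajectory (f : (Fin n → ℝ) → Fin n → ℝ)
    (g : (Fin n → ℝ) → Matrix (Fin n) (Fin m) ℝ) (w : ℝ → Fin n → ℝ) (v : ℝ → Fin m → ℝ)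
    (s σ : ℝ) (z : ℝ → Fin n → ℝ) : Prop where
  continuousOn : ContinuousOn z (Set.Ico s σ)
  integrable : ∀ t ∈ Set.Ico s σ, IntervalIntegrable
    (fun t' => f (z t') + g (z t') *ᵥ v t' + w t') MeasureTheory.volume s t
  eq_integral : ∀ t ∈ Set.Ico s σ,
    z t = z s + ∫ t' in s..t, (f (z t') + g (z t') *ᵥ v t' + w t')

/-- `t₊ = inf {t > s | ‖z(t) - z(s)‖_∞ > d or t - s > d}`, where `z` is the trajectory that runs on
with the constant input `c` (it exists on `[s, σ)` for some `σ > t₊`) and that `x` follows on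
`[s, t₊]`. The infimum is taken along `z` and not along `x`, because whether `x` leaves the ball after
`t₊` depends on the new input that is applied from `t₊` on.
The norm of `Fin n → ℝ` is the maximum norm. -/
def IsNextTrigger (f : (Fin n → ℝ) → Fin n → ℝ)
    (g : (Fin n → ℝ) → Matrix (Fin n) (Fin m) ℝ) (w : ℝ → Fin n → ℝ) (x : ℝ → Fin n → ℝ)
    (c : Fin m → ℝ) (d s tnext : ℝ) : Prop :=
  ∃ (σ : ℝ) (z : ℝ → Fin n → ℝ), tnext < σ ∧ IsTrajectory f g w (fun _ => c) s σ z ∧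
    Set.EqOn x z (Set.Icc s tnext) ∧
    IsGLB {t | s < t ∧ t < σ ∧ (d < ‖z t - z s‖ ∨ d < t - s)} tnext

/-- `x : [0, ∞) → ℝⁿ` is a solution of `ẋ = f(x) + g(x) û + w`, `x(0) = x₀`, in closed loop with the
zero-order-hold control `û(t) = u(x(tᵢ), tᵢ)` for `t ∈ [tᵢ, tᵢ₊₁)`, where `t₀ = 0` and `tᵢ₊₁` is the
first time after `tᵢ` at which `‖x(t) - x(tᵢ)‖_∞ > δᵢ` or `t - tᵢ > δᵢ` triggers, `δᵢ = δ(x(tᵢ), tᵢ)`.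
The instances increase to infinity (no Zeno behaviour), so that `û` is determined on `[0, ∞)`. -/
structure IsEventTriggeredSolution (f : (Fin n → ℝ) → Fin n → ℝ)
    (g : (Fin n → ℝ) → Matrix (Fin n) (Fin m) ℝ) (w : ℝ → Fin n → ℝ)
    (u : (Fin n → ℝ) → ℝ → Fin m → ℝ) (δ : (Fin n → ℝ) → ℝ → ℝ) (x₀ : Fin n → ℝ)
    (x : ℝ → Fin n → ℝ) (τ : ℕ → ℝ) (uhat : ℝ → Fin m → ℝ) : Prop where
  initial : x 0 = x₀
  trajectory : ∀ T : ℝ, IsTrajectory f g w uhat 0 T x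
  hold : ∀ i, ∀ t ∈ Set.Ico (τ i) (τ (i + 1)), uhat t = u (x (τ i)) (τ i)
  τ_zero : τ 0 = 0
  τ_succ : ∀ i, IsNextTrigger f g w x (u (x (τ i)) (τ i)) (δ (x (τ i)) (τ i)) (τ i) (τ (i + 1))
  τ_strictMono : StrictMono τ
  τ_tendsto : Filter.Tendsto τ Filter.atTop Filter.atTop

end Control

end

/-! As long as the held input c is within δu of u, the derivative of ρ^ψ along a trajectory is -ε q
plus a bounded term, where q = ∇ρᵀ g gᵀ ∇ρ (`RegularFunnel.exists_dissipation_bounds`). Concavity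
and boundedness of {ρ^ψ > 0} make every superlevel set compact
(`RegularFunnel.isCompact_superlevel`), and the gradient cannot vanish where ρ^ψ ≤ ρ_max < ρ_opt, so
q has a positive lower bound on the funnel. Since |ε| tends to infinity at the walls, the drift near
them points inwards for any fixed f and bounded w, and a slightly tightened funnel is invariant
(`InTightFunnel.of_isTrajectory`).

The radius δ(y, t) is half the supremum of the radii in (0, 1] for which statement 1 holds, so it
involves neither f nor w. On the compact part of the tightened funnel up to a time T it is bounded
below, and velocities are bounded; hence sampling intervals have a minimal length there
(`RegularFunnel.exists_step_lower_bound`). This excludes Zeno behaviour, and the held-input pieces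
given by Picard–Lindelöf concatenate to a global solution.

That every solution stays in Ω needs no dynamics: up to the next trigger it remains in the box on
which statement 1 guarantees membership in Ω (`IsEventTriggeredSolution.inFunnel`). From t_* on the
lower wall ρ_max - γ(t) is at least r (`IsPPCChoice.gamma_le`), and positive smoothed robustness
implies satisfaction; `robustness_of_inFunnel` combines the two. -/

/-! ### Smoothed robustness and the choice of parameters -/

section Semantics

open NonTemporalFormula

variable {n : ℕ}

lemma NonTemporalFormula.rho_conj_coe {η : ℝ} {ψ₁ ψ₂ : NonTemporalFormula n} {y : Fin n → ℝ}
    {a b : ℝ} (h₁ : ψ₁.rho η y = a) (h₂ : ψ₂.rho η y = b) :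
    (conj ψ₁ ψ₂).rho η y =
      ((-(1 / η) * Real.log (Real.exp (-η * a) + Real.exp (-η * b)) : ℝ) : EReal) := by
  simp only [NonTemporalFormula.rho, h₁, h₂]
  rw [← EReal.coe_mul, ← EReal.coe_mul, EReal.exp_coe, EReal.exp_coe,
    ← ENNReal.ofReal_add (Real.exp_pos _).le (Real.exp_pos _).le,
    ENNReal.log_ofReal_of_pos (by positivity), ← EReal.coe_mul]

lemma NonTemporalFormula.rho_conj_top_left {η : ℝ} (hη : 0 < η) {ψ₁ ψ₂ : NonTemporalFormula n}
    {y : Fin n → ℝ} (h₁ : ψ₁.rho η y = ⊤) : (conj ψ₁ ψ₂).rho η y = ψ₂.rho η y := by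
  simp only [NonTemporalFormula.rho, h₁]
  rw [EReal.coe_mul_top_of_neg (by linarith), EReal.exp_bot, zero_add, EReal.log_exp,
    ← mul_assoc, ← EReal.coe_mul]
  rw [show -(1 / η) * -η = 1 by field_simp, EReal.coe_one, one_mul]

lemma NonTemporalFormula.rho_conj_top_right {η : ℝ} (hη : 0 < η) {ψ₁ ψ₂ : NonTemporalFormula n}
    {y : Fin n → ℝ} (h₂ : ψ₂.rho η y = ⊤) : (conj ψ₁ ψ₂).rho η y = ψ₁.rho η y := by
  simp only [NonTemporalFormula.rho, h₂]
  rw [EReal.coe_mul_top_of_neg (by linarith), EReal.exp_bot, add_zero, EReal.log_exp,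
    ← mul_assoc, ← EReal.coe_mul]
  rw [show -(1 / η) * -η = 1 by field_simp, EReal.coe_one, one_mul]

/-- The robustness is identically `+∞` or a continuously differentiable real function. -/
lemma NonTemporalFormula.rho_eq_top_or_contDiff {η : ℝ} (hη : 0 < η) (ψ : NonTemporalFormula n) :
    (∀ y, ψ.rho η y = ⊤) ∨
      ∃ F : (Fin n → ℝ) → ℝ, ContDiff ℝ 1 F ∧ ∀ y, ψ.rho η y = (F y : EReal) := by
  induction ψ with
  | top => exact .inl fun _ => rfl
  | pred μ => exact .inr ⟨μ.h, μ.contDiff_h, fun _ => rfl⟩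
  | negPred μ => exact .inr ⟨fun y => -μ.h y, μ.contDiff_h.neg, fun _ => rfl⟩
  | conj ψ₁ ψ₂ ih₁ ih₂ =>
    rcases ih₁ with h₁ | ⟨F₁, hF₁, h₁⟩
    · simpa only [rho_conj_top_left hη (h₁ _)] using ih₂
    rcases ih₂ with h₂ | ⟨F₂, hF₂, h₂⟩
    · exact .inr ⟨F₁, hF₁, fun y => by rw [rho_conj_top_right hη (h₂ y), h₁]⟩
    refine .inr ⟨fun y => -(1 / η) * Real.log (Real.exp (-η * F₁ y) + Real.exp (-η * F₂ y)), ?_,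
      fun y => rho_conj_coe (h₁ y) (h₂ y)⟩
    exact contDiff_const.mul (((contDiff_const.mul hF₁).exp.add (contDiff_const.mul hF₂).exp).log
      fun y => (add_pos (Real.exp_pos _) (Real.exp_pos _)).ne')

/-- Soundness of the smoothed robustness. -/
lemma NonTemporalFormula.sat_of_rho_pos {η : ℝ} (hη : 0 < η) (ψ : NonTemporalFormula n)
    {y : Fin n → ℝ} (h : 0 < ψ.rho η y) : ψ.Sat y := by
  induction ψ with
  | top => trivial
  | pred μ => exact (EReal.coe_pos.1 h).le
  | negPred μ =>
    have := EReal.coe_pos.1 h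
    exact not_le.2 (by linarith)
  | conj ψ₁ ψ₂ ih₁ ih₂ =>
    rcases ψ₁.rho_eq_top_or_contDiff hη with h₁ | ⟨F₁, -, h₁⟩
    · exact ⟨ih₁ (by simp [h₁]), ih₂ (by rwa [rho_conj_top_left hη (h₁ y)] at h)⟩
    rcases ψ₂.rho_eq_top_or_contDiff hη with h₂ | ⟨F₂, -, h₂⟩
    · exact ⟨ih₁ (by rwa [rho_conj_top_right hη (h₂ y)] at h), ih₂ (by simp [h₂])⟩
    -- Positivity means that the two exponentials sum to less than 1, hence each of them is below 1.
    rw [rho_conj_coe (h₁ y) (h₂ y), EReal.coe_pos, neg_mul, neg_pos, ← neg_pos, ← mul_neg] at h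
    have hlog := neg_pos.1 (pos_of_mul_pos_right h (by positivity))
    have e₁ := Real.exp_pos (-η * F₁ y)
    have e₂ := Real.exp_pos (-η * F₂ y)
    have hsum := (Real.log_neg_iff (by positivity)).1 hlog
    have key : ∀ a : ℝ, Real.exp (-η * a) < 1 → 0 < a := fun a ha => by
      rw [Real.exp_lt_one_iff] at ha
      nlinarith
    refine ⟨ih₁ ?_, ih₂ ?_⟩
    · rw [h₁, EReal.coe_pos]; exact key _ (by linarith)
    · rw [h₂, EReal.coe_pos]; exact key _ (by linarith)

/-- What the control design needs to know about the robustness and the parameters. -/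
structure RegularFunnel (η : ℝ) (ψ : NonTemporalFormula n) (p : PPCParams) : Prop where
  contDiff : ContDiff ℝ 1 (ψ.rhoReal η)
  coe_rhoReal : ∀ y, ψ.rho η y = (ψ.rhoReal η y : EReal)
  concave : ConcaveOn ℝ Set.univ (ψ.rhoReal η)
  isBounded_pos : Bornology.IsBounded {y | 0 < ψ.rhoReal η y}
  ρmax_pos : 0 < p.ρmax
  exists_gt : ∃ y, p.ρmax < ψ.rhoReal η y
  γinf_pos : 0 < p.γinf
  γinf_le : p.γinf ≤ p.γ₀
  l_nonneg : 0 ≤ p.l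

lemma isBounded_of_wellPosed {η : ℝ} {ψ : NonTemporalFormula n} (h : ψ.WellPosed η) :
    Bornology.IsBounded {y | 0 < ψ.rho η y} := by
  obtain ⟨C, hC0, hC⟩ := h
  refine (Metric.isBounded_closedBall (x := (0 : Fin n → ℝ)) (r := C)).subset fun y hy => ?_
  rw [mem_closedBall_zero_iff, pi_norm_le_iff_of_nonneg hC0]
  intro i
  refine le_trans ?_ (hC y hy)
  rw [Real.norm_eq_abs]
  refine Real.abs_le_sqrt ?_
  rw [dotProduct, sq]
  exact Finset.single_le_sum (f := fun j => y j * y j) (fun j _ => mul_self_nonneg _)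
    (Finset.mem_univ i)

lemma coe_lt_of_le_sub_coe {a c : ℝ} {b : EReal} (hc : 0 < c) (h : (a : EReal) ≤ b - (c : EReal)) :
    (a : EReal) < b := by
  induction b with
  | bot => simp at h
  | top => exact EReal.coe_lt_top a
  | coe b =>
    rw [← EReal.coe_sub, EReal.coe_le_coe_iff] at h
    rw [EReal.coe_lt_coe_iff]
    linarith

lemma IsPPCChoice.tstar_nonneg {η : ℝ} {φ : TemporalFormula n} {x₀ : Fin n → ℝ}
    {p : PPCParams} (hp : IsPPCChoice η φ x₀ p) : 0 ≤ p.tstar := by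
  have h := hp.tstar_mem
  cases φ with
  | always I ψ => exact h.symm ▸ I.a_nonneg
  | eventually I ψ =>
    have := I.a_nonneg
    have h1 : 0 + I.a ≤ p.tstar := h.1
    linarith

lemma IsPPCChoice.tstar_pos {η : ℝ} {φ : TemporalFormula n} {x₀ : Fin n → ℝ}
    {p : PPCParams} (hp : IsPPCChoice η φ x₀ p) (h : -p.γ₀ + p.ρmax < p.r) : 0 < p.tstar := by
  refine hp.tstar_nonneg.lt_of_ne fun h0 => ?_
  have := hp.γ₀_le_of_tstar_eq_zero h0.symm
  linarith

/-- The case assumption reads ρ_max - r < γ₀; subtracting γ_∞ on both sides puts the argument of the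
logarithm below 1, which is what makes l nonnegative. -/
lemma IsPPCChoice.ratio_bounds {η : ℝ} {φ : TemporalFormula n} {x₀ : Fin n → ℝ}
    {p : PPCParams} (hp : IsPPCChoice η φ x₀ p) (h : -p.γ₀ + p.ρmax < p.r) :
    p.γinf < p.γ₀ ∧ (p.r + p.γinf - p.ρmax) / (-(p.γ₀ - p.γinf)) =
      (p.ρmax - p.r - p.γinf) / (p.γ₀ - p.γinf) ∧
    (p.r + p.γinf - p.ρmax) / (-(p.γ₀ - p.γinf)) < 1 := by
  have h1 := hp.γinf_le.trans (min_le_right _ _)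
  have hlt : p.γinf < p.γ₀ := by linarith
  have e : (p.r + p.γinf - p.ρmax) / (-(p.γ₀ - p.γinf)) =
      (p.ρmax - p.r - p.γinf) / (p.γ₀ - p.γinf) := by
    rw [div_neg, ← neg_div]; congr 1; ring
  refine ⟨hlt, e, ?_⟩
  rw [e, div_lt_one (by linarith)]
  linarith

lemma IsPPCChoice.regularFunnel {η : ℝ} (hη : 0 < η) {φ : TemporalFormula n}
    (hconcave : ConcaveOn ℝ Set.univ (φ.inner.rhoReal η)) (hwp : φ.inner.WellPosed η)
    {x₀ : Fin n → ℝ} {p : PPCParams} (hp : IsPPCChoice η φ x₀ p) :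
    RegularFunnel η φ.inner p := by
  rcases φ.inner.rho_eq_top_or_contDiff hη with h | ⟨F, hF, h⟩
  -- Robustness identically +∞ would exceed the real number ρ_max at x₀.
  · have := hp.lt_ρmax
    simp [h] at this
  have hreal : φ.inner.rhoReal η = F := by
    funext y; simp [rhoReal, h]
  have hcoe : ∀ y, φ.inner.rho η y = (φ.inner.rhoReal η y : EReal) := by simpa only [hreal] using h
  refine ⟨hreal ▸ hF, hcoe, hconcave, ?_, ?_, ?_, hp.γinf_pos,
    hp.γinf_le.trans (min_le_left _ _), ?_⟩
  · simpa only [hcoe, EReal.coe_pos] using isBounded_of_wellPosed hwp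
  · exact EReal.coe_pos.1 ((le_max_left _ _).trans_lt hp.lt_ρmax)
  -- The margin χ keeps ρ_max strictly below the supremum.
  · obtain ⟨y, hy⟩ := lt_iSup_iff.1 (coe_lt_of_le_sub_coe hp.χ_pos hp.ρmax_le)
    exact ⟨y, by simpa only [hcoe, EReal.coe_lt_coe_iff] using hy⟩
  · rcases le_or_gt p.r (-p.γ₀ + p.ρmax) with hc | hc
    · exact hp.l_of_le hc
    · obtain ⟨h0, hl⟩ := hp.l_of_lt hc
      rw [hl, div_neg, neg_nonneg]
      exact div_nonpos_of_nonpos_of_nonneg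
        (Real.log_nonpos h0.le (hp.ratio_bounds hc).2.2.le) hp.tstar_nonneg

namespace RegularFunnel

variable {η : ℝ} {ψ : NonTemporalFormula n} {p : PPCParams}

lemma gamma_pos (h : RegularFunnel η ψ p) (t : ℝ) : 0 < p.gamma t :=
  add_pos_of_nonneg_of_pos (mul_nonneg (sub_nonneg.2 h.γinf_le) (Real.exp_pos _).le) h.γinf_pos

lemma gamma_antitone (h : RegularFunnel η ψ p) : Antitone p.gamma := fun s t hst => by
  have h0 := sub_nonneg.2 h.γinf_le
  have h1 : -p.l * t ≤ -p.l * s := by nlinarith [h.l_nonneg]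
  unfold PPCParams.gamma
  gcongr

end RegularFunnel

lemma PPCParams.gamma_zero (p : PPCParams) : p.gamma 0 = p.γ₀ := by simp [PPCParams.gamma]

lemma PPCParams.hasDerivAt_gamma (p : PPCParams) (t : ℝ) :
    HasDerivAt p.gamma (-((p.γ₀ - p.γinf) * p.l * Real.exp (-p.l * t))) t := by
  have := ((((hasDerivAt_id t).const_mul (-p.l)).exp).const_mul (p.γ₀ - p.γinf)).add_const p.γinf
  refine this.congr_deriv ?_
  simp
  ring

lemma PPCParams.continuous_gamma (p : PPCParams) : Continuous p.gamma :=
  continuous_iff_continuousAt.2 fun t => (p.hasDerivAt_gamma t).continuousAt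

/-- Since γ decreases, it suffices to look at one time: at 0 if γ₀ is already small enough, and
otherwise at t_*, where l is tuned to give equality. -/
lemma IsPPCChoice.gamma_le {η : ℝ} {φ : TemporalFormula n} {x₀ : Fin n → ℝ}
    {p : PPCParams} (hp : IsPPCChoice η φ x₀ p) (h : RegularFunnel η φ.inner p) {t : ℝ}
    (ht : p.tstar ≤ t) : p.gamma t ≤ p.ρmax - p.r := by
  rcases le_or_gt p.r (-p.γ₀ + p.ρmax) with hc | hc
  · have := h.gamma_antitone (hp.tstar_nonneg.trans ht)
    rw [p.gamma_zero] at this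
    linarith
  · refine (h.gamma_antitone ht).trans_eq ?_
    obtain ⟨hlt, e, -⟩ := hp.ratio_bounds hc
    obtain ⟨h0, hl⟩ := hp.l_of_lt hc
    have ht := (hp.tstar_pos hc).ne'
    rw [PPCParams.gamma, show -p.l * p.tstar =
      Real.log ((p.r + p.γinf - p.ρmax) / (-(p.γ₀ - p.γinf))) by rw [hl]; field_simp,
      Real.exp_log h0, e]
    have : p.γ₀ - p.γinf ≠ 0 := (sub_pos.2 hlt).ne'
    field_simp
    ring

lemma mem_funnel_iff {η : ℝ} {ψ : NonTemporalFormula n} {p : PPCParams}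
    (h : RegularFunnel η ψ p) {y : Fin n → ℝ} {t : ℝ} :
    normalizedError η ψ p y t ∈ Set.Ioo (-1 : ℝ) 0 ↔
      p.ρmax - p.gamma t < ψ.rhoReal η y ∧ ψ.rhoReal η y < p.ρmax := by
  rw [normalizedError, Set.mem_Ioo, lt_div_iff₀ (h.gamma_pos t), div_lt_iff₀ (h.gamma_pos t)]
  constructor <;> rintro ⟨h1, h2⟩ <;> constructor <;> linarith

/-- Trajectories in the funnel satisfy the formula with the prescribed robustness. -/
lemma robustness_of_inFunnel {η : ℝ} (hη : 0 < η) {φ : TemporalFormula n} {x₀ : Fin n → ℝ}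
    {p : PPCParams} (hp : IsPPCChoice η φ x₀ p) (h : RegularFunnel η φ.inner p)
    {x : ℝ → Fin n → ℝ} (hx : ∀ t, 0 ≤ t → InFunnel η φ.inner p (x t) t) :
    (p.r : EReal) ≤ φ.rho η x 0 ∧ φ.rho η x 0 ≤ (p.ρmax : EReal) ∧ φ.Sat x 0 := by
  have upper : ∀ t, 0 ≤ t → φ.inner.rho η (x t) ≤ (p.ρmax : EReal) := fun t ht => by
    rw [h.coe_rhoReal, EReal.coe_le_coe_iff]
    exact ((mem_funnel_iff h).1 (hx t ht).2).2.le
  have lower : ∀ t, p.tstar ≤ t → (p.r : EReal) ≤ φ.inner.rho η (x t) := fun t ht => by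
    rw [h.coe_rhoReal, EReal.coe_le_coe_iff]
    have h1 := ((mem_funnel_iff h).1 (hx t (hp.tstar_nonneg.trans ht)).2).1
    have h2 := hp.gamma_le h ht
    linarith
  have sat : ∀ t, p.tstar ≤ t → φ.inner.Sat (x t) := fun t ht =>
    φ.inner.sat_of_rho_pos hη ((EReal.coe_pos.2 hp.r_pos).trans_le (lower t ht))
  have htstar := hp.tstar_mem
  cases φ with
  | always I ψ =>
    have ht : p.tstar = I.a := htstar
    have hmem : ∀ t ∈ I.shift 0, p.tstar ≤ t := fun t h => by
      have h1 : 0 + I.a ≤ t := h.1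
      linarith
    refine ⟨le_iInf₂ fun t h => lower t (hmem t h), ?_, fun t h => sat t (hmem t h)⟩
    exact (iInf₂_le I.a ⟨by simp, by simpa using I.a_le_b⟩).trans (upper _ I.a_nonneg)
  | eventually I ψ =>
    have ht : p.tstar ∈ I.shift 0 := htstar
    refine ⟨(lower _ le_rfl).trans (le_iSup₂ (f := fun t (_ : t ∈ I.shift 0) => ψ.rho η (x t))
      p.tstar ht), iSup₂_le fun t h => upper t ?_, p.tstar, ht, sat _ le_rfl⟩
    have h1 : 0 + I.a ≤ t := h.1
    linarith [I.a_nonneg]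

end Semantics

/-! ### Compactness and regularity of the funnel -/

section Funnel

open Set Filter Topology

variable {n m : ℕ} {η : ℝ} {ψ : NonTemporalFormula n} {p : PPCParams}

namespace RegularFunnel

/-- A point z of positive robustness pulls any y of the superlevel set into the bounded set {ρ^ψ >
0}: by concavity (1 - s) z + s y lies there for a fixed s > 0, and dividing by s bounds y. -/
lemma isBounded_superlevel (h : RegularFunnel η ψ p) (c : ℝ) :
    Bornology.IsBounded {y | c ≤ ψ.rhoReal η y} := by
  obtain ⟨R, hR⟩ := h.isBounded_pos.exists_norm_le
  obtain ⟨z, hz⟩ := h.exists_gt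
  have hz0 := h.ρmax_pos.trans hz
  set b := ψ.rhoReal η z with hb
  have hc := abs_nonneg c
  -- With this s the concavity bound b - s (b + |c|) equals b / 2 > 0.
  set s := b / (2 * (b + |c|)) with hs
  have hs0 : 0 < s := by positivity
  have hs1 : s ≤ 1 := by
    rw [hs, div_le_one (by positivity)]; linarith
  have hsb : s * (b + |c|) = b / 2 := by
    rw [hs]; field_simp
  refine (Metric.isBounded_closedBall (x := (0 : Fin n → ℝ)) (r := (R + ‖z‖) / s)).subset
    fun y hy => ?_
  have hconc := h.concave.2 (mem_univ z) (mem_univ y) (sub_nonneg.2 hs1) hs0.le (by ring)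
  simp only [smul_eq_mul] at hconc
  have hy' : c ≤ ψ.rhoReal η y := hy
  have hlow : -|c| ≤ ψ.rhoReal η y := (neg_abs_le c).trans hy'
  have hpos : 0 < ψ.rhoReal η ((1 - s) • z + s • y) := by
    refine lt_of_lt_of_le ?_ hconc
    rw [← hb]
    nlinarith [mul_le_mul_of_nonneg_left hlow hs0.le]
  have hnorm := hR _ hpos
  rw [mem_closedBall_zero_iff, le_div_iff₀ hs0]
  have h1 : ‖s • y‖ = s * ‖y‖ := by rw [norm_smul, Real.norm_of_nonneg hs0.le]
  have h2 : ‖(1 - s) • z‖ ≤ ‖z‖ := by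
    rw [norm_smul, Real.norm_of_nonneg (sub_nonneg.2 hs1)]
    nlinarith [norm_nonneg z]
  have h3 : s • y = ((1 - s) • z + s • y) - (1 - s) • z := by abel
  have h4 := norm_sub_le ((1 - s) • z + s • y) ((1 - s) • z)
  rw [← h3, h1] at h4
  linarith

lemma continuous_rhoReal (h : RegularFunnel η ψ p) : Continuous (ψ.rhoReal η) :=
  h.contDiff.continuous

lemma isCompact_superlevel (h : RegularFunnel η ψ p) (c : ℝ) :
    IsCompact {y | c ≤ ψ.rhoReal η y} :=
  Metric.isCompact_of_isClosed_isBounded (isClosed_le continuous_const h.continuous_rhoReal)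
    (h.isBounded_superlevel c)

lemma hasFDerivAt_rhoReal (h : RegularFunnel η ψ p) (y : Fin n → ℝ) :
    HasFDerivAt (ψ.rhoReal η) (fderiv ℝ (ψ.rhoReal η) y) y :=
  (h.contDiff.differentiable one_ne_zero y).hasFDerivAt

lemma _root_.NonTemporalFormula.fderiv_rhoReal_apply (η : ℝ) (ψ : NonTemporalFormula n)
    (y v : Fin n → ℝ) : fderiv ℝ (ψ.rhoReal η) y v = ψ.gradRho η y ⬝ᵥ v := by
  conv_lhs => rw [pi_eq_sum_univ' v]
  rw [map_sum, dotProduct]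
  refine Finset.sum_congr rfl fun i _ => ?_
  rw [map_smul, smul_eq_mul, mul_comm, NonTemporalFormula.gradRho]

lemma continuous_gradRho (h : RegularFunnel η ψ p) : Continuous (ψ.gradRho η) :=
  continuous_pi fun _ => (h.contDiff.continuous_fderiv one_ne_zero).clm_apply continuous_const

/-- The gradient of the robustness does not vanish below the global maximum. -/
lemma gradRho_ne_zero (h : RegularFunnel η ψ p) {y : Fin n → ℝ}
    (hy : ψ.rhoReal η y ≤ p.ρmax) : ψ.gradRho η y ≠ 0 := by
  intro h0
  obtain ⟨z, hz⟩ := h.exists_gt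
  have hfd : fderiv ℝ (ψ.rhoReal η) y = 0 := by
    ext v
    simp [NonTemporalFormula.fderiv_rhoReal_apply, h0]
  -- On the segment from y to a better state z, a concave function with zero slope at y cannot rise,
  -- contradicting ρ^ψ(y) ≤ ρ_max < ρ^ψ(z).
  set F : ℝ → ℝ := ψ.rhoReal η ∘ AffineMap.lineMap y z with hF
  have hFc : ConcaveOn ℝ univ F := by
    simpa only [preimage_univ] using h.concave.comp_affineMap (AffineMap.lineMap y z : ℝ →ᵃ[ℝ] (Fin n → ℝ))
  have hFd : HasDerivAt F 0 0 := by
    have h1 : HasFDerivAt (ψ.rhoReal η) (0 : (Fin n → ℝ) →L[ℝ] ℝ)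
        (AffineMap.lineMap y z (0 : ℝ)) := by
      rw [AffineMap.lineMap_apply_zero, ← hfd]; exact h.hasFDerivAt_rhoReal y
    have := h1.comp_hasDerivAt (0 : ℝ) (AffineMap.hasDerivAt_lineMap (a := y) (b := z) (x := 0))
    simpa only [zero_apply] using this
  have := hFc.slope_le_of_hasDerivAt (mem_univ 0) (mem_univ 1) one_pos hFd
  simp [slope_def_field, hF] at this
  linarith

lemma exists_gradRho_lower_bound (h : RegularFunnel η ψ p) (c : ℝ) :
    ∃ k, 0 < k ∧ ∀ y, c ≤ ψ.rhoReal η y → ψ.rhoReal η y ≤ p.ρmax →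
      k ≤ ψ.gradRho η y ⬝ᵥ ψ.gradRho η y := by
  have hK : IsCompact ({y | c ≤ ψ.rhoReal η y} ∩ {y | ψ.rhoReal η y ≤ p.ρmax}) :=
    (h.isCompact_superlevel c).inter_right (isClosed_le h.continuous_rhoReal continuous_const)
  obtain ⟨k, hk, hk'⟩ := hK.exists_forall_le' (a := 0)
    (h.continuous_gradRho.dotProduct h.continuous_gradRho).continuousOn fun y hy => by
      refine lt_of_le_of_ne (Finset.sum_nonneg fun i _ => mul_self_nonneg _) fun h0 => ?_
      exact h.gradRho_ne_zero hy.2 (dotProduct_self_eq_zero.1 h0.symm)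
  exact ⟨k, hk, fun y h1 h2 => hk' y ⟨h1, h2⟩⟩

lemma continuous_normalizedError (h : RegularFunnel η ψ p) :
    Continuous fun q : (Fin n → ℝ) × ℝ => normalizedError η ψ p q.1 q.2 :=
  ((h.continuous_rhoReal.comp continuous_fst).sub continuous_const).div
    (p.continuous_gamma.comp continuous_snd) fun q => (h.gamma_pos q.2).ne'

lemma isOpen_funnel (h : RegularFunnel η ψ p) :
    IsOpen {q : (Fin n → ℝ) × ℝ | normalizedError η ψ p q.1 q.2 ∈ Ioo (-1 : ℝ) 0} :=
  isOpen_Ioo.preimage h.continuous_normalizedError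

lemma continuousAt_controlLaw (h : RegularFunnel η ψ p)
    {g : (Fin n → ℝ) → Matrix (Fin n) (Fin m) ℝ} (hg : Continuous g) {q : (Fin n → ℝ) × ℝ}
    (hq : normalizedError η ψ p q.1 q.2 ∈ Ioo (-1 : ℝ) 0) :
    ContinuousAt (fun q : (Fin n → ℝ) × ℝ => controlLaw g η ψ p q.1 q.2) q := by
  have hξ := h.continuous_normalizedError.continuousAt (x := q)
  have hne : normalizedError η ψ p q.1 q.2 - 0 ≠ 0 := by linarith [hq.2]
  have hε : ContinuousAt (fun q : (Fin n → ℝ) × ℝ => transformedError η ψ p q.1 q.2) q := by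
    refine ContinuousAt.log (((hξ.add continuousAt_const).div
      (hξ.sub continuousAt_const) hne).neg) ?_
    refine neg_ne_zero.2 (div_ne_zero ?_ hne)
    linarith [hq.1]
  refine (hε.smul (Continuous.continuousAt ?_)).neg
  exact ((hg.comp continuous_fst).matrix_transpose).matrix_mulVec
    (h.continuous_gradRho.comp continuous_fst)

end RegularFunnel

/-! ### The sampling radius -/

/-- `d` is a radius within which the control law is defined and varies by at most `δu`. -/
def IsSamplingRadius (g : (Fin n → ℝ) → Matrix (Fin n) (Fin m) ℝ) (η : ℝ)
    (ψ : NonTemporalFormula n) (p : PPCParams) (δu : ℝ) (y : Fin n → ℝ) (t d : ℝ) : Prop :=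
  ∀ y' t', ‖y' - y‖ ≤ d → t ≤ t' → t' ≤ t + d → InFunnel η ψ p y' t' ∧
    ‖controlLaw g η ψ p y' t' - controlLaw g η ψ p y t‖ ≤ δu

open Classical in
/-- Half the supremum of the sampling radii in `(0, 1]`. -/
noncomputable def samplingRadius (g : (Fin n → ℝ) → Matrix (Fin n) (Fin m) ℝ) (η : ℝ)
    (ψ : NonTemporalFormula n) (p : PPCParams) (δu : ℝ) (y : Fin n → ℝ) (t : ℝ) : ℝ :=
  if ∃ d, (0 < d ∧ d ≤ 1) ∧ IsSamplingRadius g η ψ p δu y t d then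
    sSup {d | (0 < d ∧ d ≤ 1) ∧ IsSamplingRadius g η ψ p δu y t d} / 2
  else 1

variable {g : (Fin n → ℝ) → Matrix (Fin n) (Fin m) ℝ} {δu : ℝ}

/-- This is why a supremum is used instead of a chosen radius: a radius valid uniformly on a compact
set bounds `samplingRadius` from below there. -/
lemma half_le_samplingRadius {y : Fin n → ℝ} {t d : ℝ} (hd0 : 0 < d) (hd1 : d ≤ 1)
    (hd : IsSamplingRadius g η ψ p δu y t d) : d / 2 ≤ samplingRadius g η ψ p δu y t := by
  rw [samplingRadius, if_pos ⟨d, ⟨hd0, hd1⟩, hd⟩]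
  have : d ≤ sSup {d | (0 < d ∧ d ≤ 1) ∧ IsSamplingRadius g η ψ p δu y t d} :=
    le_csSup ⟨1, fun a ha => ha.1.2⟩ ⟨⟨hd0, hd1⟩, hd⟩
  linarith

lemma samplingRadius_pos (y : Fin n → ℝ) (t : ℝ) : 0 < samplingRadius g η ψ p δu y t := by
  by_cases h : ∃ d, (0 < d ∧ d ≤ 1) ∧ IsSamplingRadius g η ψ p δu y t d
  · obtain ⟨d, ⟨hd0, hd1⟩, hd⟩ := h
    exact (half_pos hd0).trans_le (half_le_samplingRadius hd0 hd1 hd)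
  · rw [samplingRadius, if_neg h]; exact one_pos

lemma samplingRadius_le_one (y : Fin n → ℝ) (t : ℝ) : samplingRadius g η ψ p δu y t ≤ 1 := by
  by_cases h : ∃ d, (0 < d ∧ d ≤ 1) ∧ IsSamplingRadius g η ψ p δu y t d
  · rw [samplingRadius, if_pos h]
    have : sSup {d | (0 < d ∧ d ≤ 1) ∧ IsSamplingRadius g η ψ p δu y t d} ≤ 1 :=
      csSup_le h fun a ha => ha.1.2
    linarith
  · rw [samplingRadius, if_neg h]

/-- Admissibility passes to smaller radii, and half the positive supremum lies strictly below some
admissible radius. -/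
lemma isSamplingRadius_samplingRadius {y : Fin n → ℝ} {t : ℝ}
    (h : ∃ d, (0 < d ∧ d ≤ 1) ∧ IsSamplingRadius g η ψ p δu y t d) :
    IsSamplingRadius g η ψ p δu y t (samplingRadius g η ψ p δu y t) := by
  have h' := h
  obtain ⟨d₀, ⟨hd0, hd1⟩, hd⟩ := h'
  have h0 := (half_pos hd0).trans_le (half_le_samplingRadius hd0 hd1 hd)
  have e : samplingRadius g η ψ p δu y t =
      sSup {d | (0 < d ∧ d ≤ 1) ∧ IsSamplingRadius g η ψ p δu y t d} / 2 := if_pos h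
  obtain ⟨d, hdmem, hlt⟩ := exists_lt_of_lt_csSup (s := {d | (0 < d ∧ d ≤ 1) ∧
    IsSamplingRadius g η ψ p δu y t d}) (b := samplingRadius g η ψ p δu y t) h (by linarith)
  exact fun y' t' h1 h2 h3 => hdmem.2 y' t' (h1.trans hlt.le) h2 (by linarith)

/-- The condition on ξ is open, so it holds on a thickening of K, and the control law is uniformly
continuous at K, also towards points outside K. The constraint t ≥ 0 is not open, but only later
times are compared. -/
lemma RegularFunnel.exists_isSamplingRadius_of_isCompact (h : RegularFunnel η ψ p)
    (hg : Continuous g) (hδu : 0 < δu) {K : Set ((Fin n → ℝ) × ℝ)} (hK : IsCompact K)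
    (hKΩ : ∀ q ∈ K, InFunnel η ψ p q.1 q.2) :
    ∃ d, (0 < d ∧ d ≤ 1) ∧ ∀ q ∈ K, IsSamplingRadius g η ψ p δu q.1 q.2 d := by
  obtain ⟨ε₁, hε₁, hsub⟩ := hK.exists_thickening_subset_open h.isOpen_funnel
    fun q hq => (hKΩ q hq).2
  have hunif := hK.uniformContinuousAt_of_continuousAt
    (fun q : (Fin n → ℝ) × ℝ => controlLaw g η ψ p q.1 q.2)
    (fun q hq => h.continuousAt_controlLaw hg (hKΩ q hq).2) (Metric.dist_mem_uniformity hδu)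
  obtain ⟨ε₂, hε₂, hV⟩ := Metric.mem_uniformity_dist.1 hunif
  have hd : 0 < min 1 (min (ε₁ / 2) (ε₂ / 2)) := by positivity
  refine ⟨min 1 (min (ε₁ / 2) (ε₂ / 2)), ⟨hd, min_le_left _ _⟩, ?_⟩
  rintro ⟨y, t⟩ hq y' t' h1 h2 h3
  have hdist : dist (y, t) (y', t') ≤ min 1 (min (ε₁ / 2) (ε₂ / 2)) := by
    rw [Prod.dist_eq, max_le_iff]
    refine ⟨by rwa [dist_comm, dist_eq_norm], ?_⟩
    rw [dist_comm, Real.dist_eq, abs_of_nonneg (by linarith)]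
    linarith
  have hd1 : dist (y, t) (y', t') < ε₁ := by
    linarith [hdist.trans ((min_le_right _ _).trans (min_le_left _ _))]
  have hd2 : dist (y, t) (y', t') < ε₂ := by
    linarith [hdist.trans ((min_le_right _ _).trans (min_le_right _ _))]
  refine ⟨⟨(hKΩ _ hq).1.trans h2, ?_⟩, ?_⟩
  · exact hsub (Metric.mem_thickening_iff.2 ⟨(y, t), hq, by rwa [dist_comm]⟩)
  · have := hV hd2 hq
    rw [← dist_eq_norm, dist_comm]
    exact le_of_lt this

lemma RegularFunnel.isSamplingRadius_samplingRadius (h : RegularFunnel η ψ p)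
    (hg : Continuous g) (hδu : 0 < δu) {y : Fin n → ℝ} {t : ℝ} (hy : InFunnel η ψ p y t) :
    IsSamplingRadius g η ψ p δu y t (samplingRadius g η ψ p δu y t) := by
  obtain ⟨d, hd, hd'⟩ := h.exists_isSamplingRadius_of_isCompact hg hδu
    (isCompact_singleton (x := (y, t))) (by simpa using hy)
  exact _root_.isSamplingRadius_samplingRadius ⟨d, hd, hd' _ rfl⟩

/-! ### The tightened funnel -/

/-- The funnel tightened by a factor `κ` on both sides. -/
def InTightFunnel (η : ℝ) (ψ : NonTemporalFormula n) (p : PPCParams) (κ : ℝ)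
    (y : Fin n → ℝ) (t : ℝ) : Prop :=
  0 ≤ t ∧ p.ρmax - (1 - κ) * p.gamma t ≤ ψ.rhoReal η y ∧
    ψ.rhoReal η y ≤ p.ρmax - κ * p.gamma t

lemma InTightFunnel.inFunnel (h : RegularFunnel η ψ p) {κ : ℝ} (hκ : 0 < κ)
    {y : Fin n → ℝ} {t : ℝ} (hy : InTightFunnel η ψ p κ y t) : InFunnel η ψ p y t := by
  have := mul_pos hκ (h.gamma_pos t)
  exact ⟨hy.1, (mem_funnel_iff h).2 ⟨by linarith [hy.2.1], by linarith [hy.2.2]⟩⟩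

lemma RegularFunnel.isCompact_tightFunnel (h : RegularFunnel η ψ p) {κ : ℝ} (hκ : 0 < κ)
    (T : ℝ) :
    IsCompact {q : (Fin n → ℝ) × ℝ | InTightFunnel η ψ p κ q.1 q.2 ∧ q.2 ≤ T} := by
  refine ((h.isCompact_superlevel (p.ρmax - p.γ₀)).prod (isCompact_Icc (a := 0) (b := T))
    ).of_isClosed_subset ?_ ?_
  · have hρ := h.continuous_rhoReal.comp (continuous_fst (X := Fin n → ℝ) (Y := ℝ))
    have hγ := p.continuous_gamma.comp (continuous_snd (X := Fin n → ℝ) (Y := ℝ))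
    exact ((isClosed_le continuous_const continuous_snd).inter
      ((isClosed_le (continuous_const.sub (continuous_const.mul hγ)) hρ).inter
        (isClosed_le hρ (continuous_const.sub (continuous_const.mul hγ))))).inter
      (isClosed_le continuous_snd continuous_const)
  · rintro ⟨y, t⟩ ⟨hy, ht⟩
    have h0 := (mem_funnel_iff h).1 (hy.inFunnel h hκ).2
    have h1 := h.gamma_antitone hy.1
    rw [p.gamma_zero] at h1
    exact ⟨show p.ρmax - p.γ₀ ≤ ψ.rhoReal η y by linarith [h0.1], hy.1, ht⟩

end Funnel

/-! ### Trajectories with held input -/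

section Trajectories

open Set Filter Topology MeasureTheory
open scoped NNReal

variable {n m : ℕ}

/-- Off a finite, hence null, set w is continuous, which gives measurability; the bound M does the
rest. -/
lemma PiecewiseContinuous.intervalIntegrable {w : ℝ → Fin n → ℝ} (hw : PiecewiseContinuous w)
    {M : ℝ} (hM : ∀ t, 0 ≤ t → ‖w t‖ ≤ M) {a b : ℝ} (ha : 0 ≤ a) (hb : 0 ≤ b) :
    IntervalIntegrable w volume a b := by
  have key : ∀ T, IntegrableOn w (Icc 0 T) := fun T => by
    set S := {t | t ∈ Icc 0 T ∧ ¬ ContinuousWithinAt w (Ici 0) t} with hS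
    have hfin : S.Finite := hw.finite_discontinuities T
    have hae : (Icc 0 T \ S : Set ℝ) =ᵐ[volume] Icc 0 T :=
      sdiff_null_ae_eq_self (hfin.measure_zero _)
    have hcont : ContinuousOn w (Icc 0 T \ S) := fun t ht => by
      have : ContinuousWithinAt w (Ici 0) t := by_contra fun h => ht.2 ⟨ht.1, h⟩
      exact this.mono (sdiff_subset.trans Icc_subset_Ici_self)
    have hmeas := hcont.aestronglyMeasurable (μ := volume)
      (measurableSet_Icc.diff hfin.measurableSet)
    rw [Measure.restrict_congr_set hae] at hmeas
    refine IntegrableOn.of_bound measure_Icc_lt_top hmeas M ?_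
    exact (ae_restrict_iff' measurableSet_Icc).2 (.of_forall fun t ht => hM t ht.1)
  refine ((key (max a b)).mono_set ?_).intervalIntegrable
  exact Icc_subset_Icc (le_min ha hb) le_rfl

/-- Clamping the coordinates retracts onto a closed ball of the maximum norm. -/
lemma exists_nonexpansive_retraction (y : Fin n → ℝ) {R : ℝ} (hR : 0 ≤ R) :
    ∃ P : (Fin n → ℝ) → Fin n → ℝ, LipschitzWith 1 P ∧ (∀ v, P v ∈ Metric.closedBall y R) ∧
      ∀ v ∈ Metric.closedBall y R, P v = v := by
  refine ⟨fun v i => max (y i - R) (min (y i + R) (v i)), ?_, fun v => ?_, fun v hv => ?_⟩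
  · refine LipschitzWith.of_dist_le_mul fun u v => (dist_pi_le_iff (by positivity)).2 fun i => ?_
    have hi := ((LipschitzWith.id.const_min (y i + R)).const_max (y i - R)).dist_le_mul (u i) (v i)
    refine hi.trans ?_
    gcongr
    exact dist_le_pi_dist u v i
  · refine (dist_pi_le_iff hR).2 fun i => ?_
    rw [Real.dist_eq, abs_le]
    constructor
    · linarith [le_max_left (y i - R) (min (y i + R) (v i))]
    · have : max (y i - R) (min (y i + R) (v i)) ≤ y i + R :=
        max_le (by linarith) (min_le_left _ _)
      linarith
  · funext i
    have h := (dist_pi_le_iff hR).1 hv i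
    rw [Real.dist_eq, abs_le] at h
    change max (y i - R) (min (y i + R) (v i)) = v i
    rw [min_eq_right (by linarith), max_eq_right (by linarith)]

lemma lipschitzOnWith_mulVec {g : (Fin n → ℝ) → Matrix (Fin n) (Fin m) ℝ}
    (hg : ∀ i j, LocallyLipschitz (fun y => g y i j)) {K : Set (Fin n → ℝ)} (hK : IsCompact K)
    (c : Fin m → ℝ) : ∃ L, LipschitzOnWith L (fun y => g y *ᵥ c) K := by
  choose L hL using fun i j =>
    ((hg i j).locallyLipschitzOn (s := K)).exists_lipschitzOnWith_of_compact hK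
  refine ⟨∑ i, ∑ j, L i j * ‖c j‖₊, LipschitzOnWith.of_dist_le_mul fun u hu v hv => ?_⟩
  refine (dist_pi_le_iff (by positivity)).2 fun i => ?_
  have h1 : dist ((g u *ᵥ c) i) ((g v *ᵥ c) i) ≤ (∑ j, L i j * ‖c j‖₊ : ℝ≥0) * dist u v := by
    rw [Real.dist_eq, Matrix.mulVec, Matrix.mulVec, dotProduct, dotProduct,
      ← Finset.sum_sub_distrib]
    refine (Finset.abs_sum_le_sum_abs _ _).trans ?_
    push_cast
    rw [Finset.sum_mul]
    refine Finset.sum_le_sum fun j _ => ?_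
    rw [← sub_mul, abs_mul, ← Real.dist_eq, ← Real.norm_eq_abs]
    have := (hL i j).dist_le_mul u hu v hv
    calc dist (g u i j) (g v i j) * ‖c j‖ ≤ L i j * dist u v * ‖c j‖ := by gcongr
      _ = _ := by ring
  refine h1.trans (mul_le_mul_of_nonneg_right ?_ dist_nonneg)
  exact_mod_cast Finset.single_le_sum (f := fun i => ∑ j, L i j * ‖c j‖₊) (fun i _ => by positivity)
    (Finset.mem_univ i)

lemma continuous_of_locallyLipschitz_entries {g : (Fin n → ℝ) → Matrix (Fin n) (Fin m) ℝ}
    (hg : ∀ i j, LocallyLipschitz (fun y => g y i j)) : Continuous g :=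
  continuous_matrix fun i j => (hg i j).continuous

variable {f : (Fin n → ℝ) → Fin n → ℝ} {g : (Fin n → ℝ) → Matrix (Fin n) (Fin m) ℝ}
  {w : ℝ → Fin n → ℝ}

/-- The held-input system has a solution for as long as it stays in the ball of radius `2`. -/
lemma exists_isTrajectory (hf : LocallyLipschitz f)
    (hg : ∀ i j, LocallyLipschitz (fun y => g y i j)) (hw : PiecewiseContinuous w)
    {M : ℝ} (hM : ∀ t, 0 ≤ t → ‖w t‖ ≤ M) {s : ℝ} (hs : 0 ≤ s) (y : Fin n → ℝ) (c : Fin m → ℝ) :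
    ∃ z : ℝ → Fin n → ℝ, z s = y ∧ ContinuousOn z (Icc s (s + 2)) ∧
      ∀ σ ≤ s + 2, (∀ t ∈ Ico s σ, ‖z t - y‖ ≤ 2) → IsTrajectory f g w (fun _ => c) s σ z := by
  obtain ⟨P, hP, hPmem, hPid⟩ := exists_nonexpansive_retraction y (zero_le_two (α := ℝ))
  have hball : IsCompact (Metric.closedBall y 2) := isCompact_closedBall y 2
  obtain ⟨K₁, hK₁⟩ := (hf.locallyLipschitzOn (s := Metric.closedBall y 2)
    ).exists_lipschitzOnWith_of_compact hball
  obtain ⟨K₂, hK₂⟩ := lipschitzOnWith_mulVec hg hball c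
  set F : (Fin n → ℝ) → Fin n → ℝ := fun v => f v + g v *ᵥ c with hF
  have hFlip : LipschitzOnWith (K₁ + K₂) F (Metric.closedBall y 2) := hK₁.add hK₂
  have hFP : LipschitzWith (K₁ + K₂) (F ∘ P) := by
    have := hFlip.comp (hP.lipschitzOnWith (s := univ)) fun v _ => hPmem v
    rwa [mul_one, lipschitzOnWith_univ] at this
  obtain ⟨L₀, hL₀⟩ := hball.exists_bound_of_continuousOn hFlip.continuousOn
  have hL0 : 0 ≤ L₀ := (norm_nonneg _).trans (hL₀ y (Metric.mem_closedBall_self zero_le_two))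
  set L : ℝ≥0 := ⟨L₀, hL0⟩
  -- Subtracting the primitive of w from the state leaves an equation whose right-hand side is
  -- continuous in time, so Picard–Lindelöf applies in spite of the jumps of w.
  set I : ℝ → Fin n → ℝ := fun t => ∫ t' in s..t, w t' with hI
  have hwint : ∀ t, s ≤ t → IntervalIntegrable w volume s t := fun t ht =>
    hw.intervalIntegrable hM hs (hs.trans ht)
  have hs2 : s ≤ s + 2 := by linarith
  have hIcont : ContinuousOn I (Icc s (s + 2)) := by
    have := intervalIntegral.continuousOn_primitive_interval' (hwint _ hs2) left_mem_uIcc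
    rwa [uIcc_of_le hs2] at this
  -- The clamped field is globally Lipschitz and bounded by L, so over a time span of 2 the solution
  -- moves at most 2 L.
  have hPL : IsPicardLindelof (fun t v => F (P (v + I t))) (tmin := s) (tmax := s + 2)
      ⟨s, le_rfl, hs2⟩ y (2 * L) 0 L (K₁ + K₂) := by
    refine ⟨fun t _ => LipschitzWith.lipschitzOnWith ?_, fun v _ => ?_, fun t _ v _ =>
      hL₀ _ (hPmem _), ?_⟩
    · have := hFP.comp (LipschitzWith.id.add (LipschitzWith.const (I t)))
      rwa [add_zero, mul_one] at this
    · exact hFP.continuous.comp_continuousOn (continuousOn_const.add hIcont)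
    · simp [mul_comm]
  obtain ⟨α, hα0, hα⟩ := hPL.exists_eq_forall_mem_Icc_hasDerivWithinAt₀
  have hαcont : ContinuousOn α (Icc s (s + 2)) := fun t ht => (hα t ht).continuousWithinAt
  have hzcont : ContinuousOn (fun t => α t + I t) (Icc s (s + 2)) := hαcont.add hIcont
  have hI0 : I s = 0 := intervalIntegral.integral_same
  have hα0' : α s = y := hα0
  refine ⟨fun t => α t + I t, by simp [hα0', hI0], hzcont, fun σ hσ hstay => ?_⟩
  have hΦ : ∀ t ∈ Ico s σ,
      IntervalIntegrable (fun t' => F (P (α t' + I t'))) volume s t := fun t ht => by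
    refine (hFP.continuous.comp_continuousOn (hzcont.mono ?_)).intervalIntegrable
    rw [uIcc_of_le ht.1]
    exact Icc_subset_Icc le_rfl (ht.2.le.trans hσ)
  -- While the solution stays in the ball the clamp acts as the identity, and the original field
  -- reappears.
  have heq : ∀ t ∈ Ico s σ, EqOn (fun t' => F (P (α t' + I t')) + w t')
      (fun t' => f (α t' + I t') + g (α t' + I t') *ᵥ c + w t') (uIcc s t) := fun t ht t' ht' => by
    rw [uIcc_of_le ht.1] at ht'
    have := hPid (α t' + I t') (by
      rw [mem_closedBall_iff_norm]; exact hstay t' ⟨ht'.1, ht'.2.trans_lt ht.2⟩)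
    simp only [this, hF]
  refine ⟨hzcont.mono fun t ht => ⟨ht.1, ht.2.le.trans hσ⟩, fun t ht => ?_, fun t ht => ?_⟩
  · exact ((hΦ t ht).add (hwint t ht.1)).congr ((heq t ht).mono uIoc_subset_uIcc)
  · rw [← intervalIntegral.integral_congr (heq t ht),
      intervalIntegral.integral_add (hΦ t ht) (hwint t ht.1)]
    have hsub : Icc s t ⊆ Icc s (s + 2) := Icc_subset_Icc le_rfl (ht.2.le.trans hσ)
    rw [intervalIntegral.integral_eq_sub_of_hasDeriv_right_of_le ht.1 (hαcont.mono hsub)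
      (fun x hx => ((hα x (hsub (Ioo_subset_Icc_self hx))).hasDerivAt
        (Icc_mem_nhds hx.1 (hx.2.trans_le (hsub (right_mem_Icc.2 ht.1)).2))).hasDerivWithinAt)
      (hΦ t ht)]
    simp only [hI, intervalIntegral.integral_same]
    abel

/-- Right derivative of a trajectory with held input. -/
lemma IsTrajectory.hasDerivWithinAt (hf : Continuous f) (hg : Continuous g) {c : Fin m → ℝ}
    {s σ : ℝ} {z : ℝ → Fin n → ℝ} (hz : IsTrajectory f g w (fun _ => c) s σ z) {t : ℝ}
    (ht : t ∈ Ico s σ) {ω : Fin n → ℝ} (hω : Tendsto w (𝓝[>] t) (𝓝 ω)) :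
    HasDerivWithinAt z (f (z t) + g (z t) *ᵥ c + ω) (Ici t) t := by
  have hnear : Ico s σ ∈ 𝓝[≥] t := mem_of_superset (Ico_mem_nhdsGE ht.2) (Ico_subset_Ico_left ht.1)
  have hle : 𝓝[>] t ≤ 𝓝[Ico s σ] t :=
    (nhdsWithin_mono t Ioi_subset_Ici_self).trans (nhdsWithin_le_of_mem hnear)
  have hzt : Tendsto z (𝓝[>] t) (𝓝 (z t)) := (hz.continuousOn t ht).mono_left hle
  have hmeas : StronglyMeasurableAtFilter (fun t' => f (z t') + g (z t') *ᵥ c + w t')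
      (𝓝[>] t) := by
    obtain ⟨t₁, ht₁, ht₁'⟩ := exists_between ht.2
    refine ⟨Ioc t t₁, Ioc_mem_nhdsGT ht₁, ?_⟩
    have h1 := (hz.integrable t₁ ⟨ht.1.trans ht₁.le, ht₁'⟩).1.aestronglyMeasurable
    exact h1.mono_measure (Measure.restrict_mono (Ioc_subset_Ioc_left ht.1) le_rfl)
  -- Only the right limit of w enters, so the right derivative exists at jumps as well.
  have hlim : Tendsto (fun t' => f (z t') + g (z t') *ᵥ c + w t') (𝓝[>] t)
      (𝓝 (f (z t) + g (z t) *ᵥ c + ω)) := by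
    have hF : Continuous fun v => f v + g v *ᵥ c := hf.add (hg.matrix_mulVec continuous_const)
    exact ((hF.tendsto (z t)).comp hzt).add hω
  have hder := intervalIntegral.integral_hasDerivWithinAt_of_tendsto_ae_right
    (hz.integrable t ht) (s := Ici t) (t := Ioi t) hmeas (hlim.mono_left inf_le_left)
  exact (hder.const_add (z s)).congr_of_eventuallyEq
    (mem_of_superset hnear hz.eq_integral) (hz.eq_integral t ht)

/-! ### Trigger times -/

/-- The set of times after `s` at which the trigger condition holds. -/
def triggerSet (z : ℝ → Fin n → ℝ) (d s σ : ℝ) : Set ℝ :=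
  {t | s < t ∧ t < σ ∧ (d < ‖z t - z s‖ ∨ d < t - s)}

/-- Before the infimum nothing triggers; at the infimum the non-strict bounds survive by continuity.
-/
lemma le_of_isGLB_triggerSet {z : ℝ → Fin n → ℝ} {d s σ τ : ℝ} (hd : 0 ≤ d)
    (hz : ContinuousOn z (Ico s σ)) (hτ : IsGLB (triggerSet z d s σ) τ) (hτσ : τ < σ) {t : ℝ}
    (ht : t ∈ Icc s τ) : ‖z t - z s‖ ≤ d ∧ t - s ≤ d := by
  have hlt : ∀ t ∈ Ico s τ, ‖z t - z s‖ ≤ d ∧ t - s ≤ d := fun t ht => by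
    rcases ht.1.eq_or_lt with rfl | hst
    · simpa using hd
    by_contra hcon
    have hmem : t ∈ triggerSet z d s σ := by
      refine ⟨hst, ht.2.trans hτσ, ?_⟩
      by_contra! h
      exact hcon h
    exact ht.2.not_ge (hτ.1 hmem)
  rcases ht.2.lt_or_eq with h | rfl
  · exact hlt t ⟨ht.1, h⟩
  rcases ht.1.eq_or_lt with rfl | hst
  · simpa using hd
  have hcl : t ∈ closure (Ico s t) := by
    rw [closure_Ico hst.ne]; exact ⟨hst.le, le_rfl⟩
  have hzc : ContinuousWithinAt z (Ico s t) t :=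
    (hz t ⟨hst.le, hτσ⟩).mono (Ico_subset_Ico_right hτσ.le)
  constructor
  · exact ((hzc.sub continuousWithinAt_const).norm.closure_le hcl continuousWithinAt_const
      fun u hu => (hlt u hu).1)
  · exact ((continuousWithinAt_id.sub continuousWithinAt_const).closure_le hcl
      continuousWithinAt_const fun u hu => (hlt u hu).2)

/-- If both strict inequalities held at the infimum, they would persist slightly beyond it and no
trigger times could accumulate there. For d > 0 this forces progress in time. -/
lemma trigger_of_isGLB_triggerSet {z : ℝ → Fin n → ℝ} {d s σ τ : ℝ}
    (hz : ContinuousOn z (Ico s σ)) (hτ : IsGLB (triggerSet z d s σ) τ) (hsτ : s ≤ τ)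
    (hτσ : τ < σ) : d ≤ ‖z τ - z s‖ ∨ d ≤ τ - s := by
  by_contra! hcon
  have hnear : Ico s σ ∈ 𝓝[≥] τ := mem_of_superset (Ico_mem_nhdsGE hτσ) (Ico_subset_Ico_left hsτ)
  have hzc : Tendsto z (𝓝[≥] τ) (𝓝 (z τ)) :=
    (hz τ ⟨hsτ, hτσ⟩).mono_left (nhdsWithin_le_of_mem hnear)
  have h1 : ∀ᶠ t in 𝓝[≥] τ, ‖z t - z s‖ < d :=
    (hzc.sub_const (z s)).norm.eventually_lt_const hcon.1
  have h2 : ∀ᶠ t in 𝓝[≥] τ, t - s < d :=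
    ((tendsto_id.mono_left nhdsWithin_le_nhds).sub_const s).eventually_lt_const hcon.2
  obtain ⟨u, hu, hsub⟩ := (mem_nhdsGE_iff_exists_Ico_subset).1 (h1.and h2)
  have hlow : u ∈ lowerBounds (triggerSet z d s σ) := fun t ht => by
    by_contra! htu
    obtain ⟨h3, h4⟩ := hsub ⟨hτ.1 ht, htu⟩
    rcases ht.2.2 with h | h
    · exact h.not_gt h3
    · exact h.not_gt h4
  exact (hτ.2 hlow).not_gt hu

/-- From every state the held-input trajectory runs until after the next trigger. -/
lemma exists_trigger (hf : LocallyLipschitz f)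
    (hg : ∀ i j, LocallyLipschitz (fun y => g y i j)) (hw : PiecewiseContinuous w)
    {M : ℝ} (hM : ∀ t, 0 ≤ t → ‖w t‖ ≤ M) {s : ℝ} (hs : 0 ≤ s) (y : Fin n → ℝ) (c : Fin m → ℝ)
    {d : ℝ} (hd0 : 0 < d) (hd1 : d ≤ 1) :
    ∃ (τ σ : ℝ) (z : ℝ → Fin n → ℝ), s < τ ∧ τ < σ ∧ z s = y ∧
      IsTrajectory f g w (fun _ => c) s σ z ∧ IsGLB (triggerSet z d s σ) τ := by
  obtain ⟨z, hzs, hzc, hz⟩ := exists_isTrajectory hf hg hw hM hs y c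
  have hzc' : ContinuousOn z (Ico s (s + 2)) := hzc.mono Ico_subset_Icc_self
  -- As d ≤ 1, the time condition has triggered by s + 3/2, within the existence interval of length
  -- 2.
  have hmem : s + 3 / 2 ∈ triggerSet z d s (s + 2) :=
    ⟨by linarith, by linarith, .inr (by linarith)⟩
  set τ := sInf (triggerSet z d s (s + 2)) with hτdef
  have hGLB : IsGLB (triggerSet z d s (s + 2)) τ :=
    isGLB_csInf ⟨_, hmem⟩ ⟨s, fun t ht => ht.1.le⟩
  have hsτ : s ≤ τ := hGLB.2 fun t ht => ht.1.le
  have hτ2 : τ < s + 2 := (hGLB.1 hmem).trans_lt (by linarith)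
  have htrig := trigger_of_isGLB_triggerSet hzc' hGLB hsτ hτ2
  have hsτ' : s < τ := by
    refine hsτ.lt_of_ne fun h => ?_
    rw [← h] at htrig
    simp only [sub_self, norm_zero, or_self] at htrig
    exact htrig.not_gt hd0
  have hstay := fun t (ht : t ∈ Icc s τ) => le_of_isGLB_triggerSet hd0.le hzc' hGLB hτ2 ht
  have hnear : Ico s (s + 2) ∈ 𝓝[≥] τ :=
    mem_of_superset (Ico_mem_nhdsGE hτ2) (Ico_subset_Ico_left hsτ)
  have hzτ : Tendsto z (𝓝[≥] τ) (𝓝 (z τ)) :=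
    (hzc' τ ⟨hsτ, hτ2⟩).mono_left (nhdsWithin_le_of_mem hnear)
  -- At τ the state has moved at most d ≤ 1, so it stays within distance 2 a little longer; this
  -- gives the horizon beyond τ.
  have h1 : ∀ᶠ t in 𝓝[≥] τ, ‖z t - y‖ < 2 := by
    refine (hzτ.sub_const y).norm.eventually_lt_const ?_
    have := (hstay τ ⟨hsτ, le_rfl⟩).1
    rw [hzs] at this
    linarith
  obtain ⟨u, hu, hsub⟩ := (mem_nhdsGE_iff_exists_Ico_subset).1 h1
  have hu' : τ < u := hu
  refine ⟨τ, min u (s + 2), z, hsτ', lt_min hu' hτ2, hzs, hz _ (min_le_right _ _) ?_, ?_⟩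
  · intro t ht
    rcases le_or_gt t τ with h | h
    · have := (hstay t ⟨ht.1, h⟩).1
      rw [hzs] at this
      linarith
    · exact (show ‖z t - y‖ < 2 from hsub ⟨h.le, ht.2.trans_le (min_le_left _ _)⟩).le
  -- Shortening the horizon keeps the infimum, since there are trigger times arbitrarily close to τ.
  · refine ⟨fun t ht => hGLB.1 ⟨ht.1, ht.2.1.trans_le (min_le_right _ _), ht.2.2⟩,
      fun b hb => ?_⟩
    by_contra! hlt
    obtain ⟨t, ht, hτt, htb⟩ := hGLB.exists_between (lt_min hlt (lt_min hu' hτ2))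
    exact (hb ⟨ht.1, htb.trans_le (min_le_right _ _), ht.2.2⟩).not_gt
      (htb.trans_le (min_le_left _ _))

end Trajectories

/-! ### Invariance of the tightened funnel and minimal step length -/

section ClosedLoop

open Set Filter Topology MeasureTheory
open scoped NNReal

variable {n m : ℕ} {η : ℝ} {ψ : NonTemporalFormula n} {p : PPCParams}
  {f : (Fin n → ℝ) → Fin n → ℝ} {g : (Fin n → ℝ) → Matrix (Fin n) (Fin m) ℝ}
  {w : ℝ → Fin n → ℝ}

lemma InFunnel.mem_superlevel (h : RegularFunnel η ψ p) {y : Fin n → ℝ} {t : ℝ}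
    (hy : InFunnel η ψ p y t) : p.ρmax - p.γ₀ ≤ ψ.rhoReal η y := by
  have h1 := (mem_funnel_iff h).1 hy.2
  have h2 := h.gamma_antitone hy.1
  rw [p.gamma_zero] at h2
  linarith [h1.1]

/-- Up to a bounded term the robustness evolves by `-ε` times a quadratic form bounded below. -/
lemma RegularFunnel.exists_dissipation_bounds (h : RegularFunnel η ψ p) (hf : Continuous f)
    (hg : Continuous g)
    (hgpos : ∃ lam : ℝ, 0 < lam ∧ ∀ y z : Fin n → ℝ, lam * (z ⬝ᵥ z) ≤ z ⬝ᵥ ((g y * (g y)ᵀ) *ᵥ z))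
    (M δu : ℝ) :
    ∃ B k : ℝ, 0 < k ∧ ∀ y t ω c, InFunnel η ψ p y t → ‖ω‖ ≤ M →
      ‖controlLaw g η ψ p y t - c‖ ≤ δu → ∃ q, k ≤ q ∧
        |ψ.gradRho η y ⬝ᵥ (f y + g y *ᵥ c + ω) + transformedError η ψ p y t * q| ≤ B := by
  obtain ⟨lam, hlam, hlb⟩ := hgpos
  obtain ⟨k, hk, hklb⟩ := h.exists_gradRho_lower_bound (p.ρmax - p.γ₀)
  -- The part of the drift left after cancelling -ε q; its last variable is the input error u - c.
  set D : (Fin n → ℝ) × (Fin n → ℝ) × (Fin m → ℝ) → ℝ := fun q =>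
    ψ.gradRho η q.1 ⬝ᵥ (f q.1 + q.2.1 - g q.1 *ᵥ q.2.2) with hD
  have hDc : Continuous D := by
    refine (h.continuous_gradRho.comp continuous_fst).dotProduct ?_
    exact ((hf.comp continuous_fst).add (continuous_fst.comp continuous_snd)).sub
      ((hg.comp continuous_fst).matrix_mulVec (continuous_snd.comp continuous_snd))
  obtain ⟨B, hB⟩ := ((h.isCompact_superlevel (p.ρmax - p.γ₀)).prod
    ((isCompact_closedBall (0 : Fin n → ℝ) M).prod
      (isCompact_closedBall (0 : Fin m → ℝ) δu))).exists_bound_of_continuousOn hDc.continuousOn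
  refine ⟨B, lam * k, mul_pos hlam hk, fun y t ω c hy hω hc => ?_⟩
  have hy0 := hy.mem_superlevel h
  refine ⟨ψ.gradRho η y ⬝ᵥ ((g y * (g y)ᵀ) *ᵥ ψ.gradRho η y), ?_, ?_⟩
  · refine le_trans ?_ (hlb y _)
    exact mul_le_mul_of_nonneg_left (hklb y hy0 ((mem_funnel_iff h).1 hy.2).2.le) hlam.le
  · have hbound := hB (y, ω, controlLaw g η ψ p y t - c)
      ⟨hy0, mem_closedBall_zero_iff.2 hω, mem_closedBall_zero_iff.2 hc⟩
    rw [Real.norm_eq_abs] at hbound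
    convert hbound using 2
    simp only [hD, controlLaw, Matrix.mulVec_sub, Matrix.mulVec_neg, Matrix.mulVec_smul,
      dotProduct_add, dotProduct_sub, dotProduct_neg, dotProduct_smul, Matrix.mulVec_mulVec,
      smul_eq_mul]
    ring

/-- On a tightened wall ξ is constant, so ε takes one value there, independent of y and t; it grows
without bound as κ tends to 0. -/
lemma transformedError_eq_of_upper (h : RegularFunnel η ψ p) {κ : ℝ} {y : Fin n → ℝ}
    {t : ℝ} (hy : ψ.rhoReal η y = p.ρmax - κ * p.gamma t) :
    transformedError η ψ p y t = Real.log ((1 - κ) / κ) := by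
  have hγ := (h.gamma_pos t).ne'
  have : normalizedError η ψ p y t = -κ := by
    rw [normalizedError, hy]; field_simp; ring
  rw [transformedError, transformation, this]
  congr 1
  rw [sub_zero, div_neg, neg_neg]
  ring

lemma transformedError_eq_of_lower (h : RegularFunnel η ψ p) {κ : ℝ} {y : Fin n → ℝ}
    {t : ℝ} (hy : ψ.rhoReal η y = p.ρmax - (1 - κ) * p.gamma t) :
    transformedError η ψ p y t = -Real.log ((1 - κ) / κ) := by
  rw [transformedError_eq_of_upper h hy, ← Real.log_inv, inv_div]
  congr 2
  ring

/-- The tightened funnel is invariant between two samples if its walls are steep enough. -/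
lemma InTightFunnel.of_isTrajectory (h : RegularFunnel η ψ p) (hf : Continuous f)
    (hg : Continuous g) (hw : PiecewiseContinuous w) {M : ℝ} (hM : ∀ t, 0 ≤ t → ‖w t‖ ≤ M)
    {B k δu κ : ℝ}
    (hBk : ∀ y t ω c, InFunnel η ψ p y t → ‖ω‖ ≤ M →
      ‖controlLaw g η ψ p y t - c‖ ≤ δu → ∃ q, k ≤ q ∧
        |ψ.gradRho η y ⬝ᵥ (f y + g y *ᵥ c + ω) + transformedError η ψ p y t * q| ≤ B)
    (hκ0 : 0 < κ) (hκ1 : κ < 1) (hΛ : 0 ≤ Real.log ((1 - κ) / κ))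
    (hκ : B + (p.γ₀ - p.γinf) * p.l < k * Real.log ((1 - κ) / κ))
    {c : Fin m → ℝ} {s σ τ : ℝ} {z : ℝ → Fin n → ℝ} (hτσ : τ < σ)
    (hz : IsTrajectory f g w (fun _ => c) s σ z) (hs : InTightFunnel η ψ p κ (z s) s)
    (hΩ : ∀ t ∈ Icc s τ, InFunnel η ψ p (z t) t ∧ ‖controlLaw g η ψ p (z t) t - c‖ ≤ δu)
    {t : ℝ} (ht : t ∈ Icc s τ) : InTightFunnel η ψ p κ (z t) t := by
  have hpos : ∀ t ∈ Icc s τ, 0 ≤ t := fun t ht => hs.1.trans ht.1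
  choose! ω hω using hw.right_limit
  have hωM : ∀ t, 0 ≤ t → ‖ω t‖ ≤ M := fun t ht => by
    refine le_of_tendsto (hω t ht).norm ?_
    filter_upwards [self_mem_nhdsWithin] with u hu
    exact hM u (ht.trans (le_of_lt hu))
  set R : ℝ → ℝ := fun t => ψ.gradRho η (z t) ⬝ᵥ (f (z t) + g (z t) *ᵥ c + ω t) with hR
  have hder : ∀ t ∈ Ico s τ, HasDerivWithinAt (fun t => ψ.rhoReal η (z t)) (R t) (Ici t) t := by
    intro t ht
    have h1 := hz.hasDerivWithinAt hf hg ⟨ht.1, ht.2.trans hτσ⟩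
      (hω t (hpos t (Ico_subset_Icc_self ht)))
    have h2 := (h.hasFDerivAt_rhoReal (z t)).comp_hasDerivWithinAt t h1
    rwa [NonTemporalFormula.fderiv_rhoReal_apply] at h2
  have hcont : ContinuousOn (fun t => ψ.rhoReal η (z t)) (Icc s τ) :=
    h.continuous_rhoReal.comp_continuousOn
      (hz.continuousOn.mono fun t ht => ⟨ht.1, ht.2.trans_lt hτσ⟩)
  have hG : 0 ≤ (p.γ₀ - p.γinf) * p.l := mul_nonneg (sub_nonneg.2 h.γinf_le) h.l_nonneg
  have hexp : ∀ t ∈ Ico s τ, (p.γ₀ - p.γinf) * p.l * Real.exp (-p.l * t) ≤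
      (p.γ₀ - p.γinf) * p.l := fun t ht => by
    refine mul_le_of_le_one_right hG (Real.exp_le_one_iff.2 ?_)
    nlinarith [h.l_nonneg, hpos t (Ico_subset_Icc_self ht)]
  have hexp0 : ∀ t, 0 ≤ (p.γ₀ - p.γinf) * p.l * Real.exp (-p.l * t) := fun t =>
    mul_nonneg hG (Real.exp_pos _).le
  refine ⟨hpos t ht, ?_, ?_⟩
  -- At contact with the lower wall ρ^ψ rises at rate at least kΛ - B, with Λ = ln((1 - κ)/κ), while
  -- the wall rises no faster than (γ₀ - γ_∞) l.
  · have := image_le_of_deriv_right_lt_deriv_boundary hcont.neg (fun t ht => (hder t ht).neg)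
      (B := fun t => -(p.ρmax - (1 - κ) * p.gamma t)) (neg_le_neg hs.2.1)
      (fun t => (((p.hasDerivAt_gamma t).const_mul (1 - κ)).const_sub p.ρmax).neg) ?_ ht
    · exact neg_le_neg_iff.1 this
    · intro t ht heq
      obtain ⟨hfun, hu⟩ := hΩ t (Ico_subset_Icc_self ht)
      obtain ⟨q, hq, hb⟩ := hBk _ t (ω t) c hfun (hωM t (hpos t (Ico_subset_Icc_self ht))) hu
      rw [transformedError_eq_of_lower h (neg_injective heq)] at hb
      have h1 := (abs_le.1 hb).1
      have h2 := mul_le_mul_of_nonneg_right hq hΛ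
      have h3 := mul_le_of_le_one_left (hexp0 t) (show 1 - κ ≤ 1 by linarith)
      have h4 := hexp t ht
      simp only [hR]
      linarith
  -- At contact with the upper wall ρ^ψ strictly decreases, whereas that wall never descends.
  · refine image_le_of_deriv_right_lt_deriv_boundary hcont hder
      (B := fun t => p.ρmax - κ * p.gamma t) hs.2.2
      (fun t => ((p.hasDerivAt_gamma t).const_mul κ).const_sub p.ρmax) ?_ ht
    intro t ht heq
    obtain ⟨hfun, hu⟩ := hΩ t (Ico_subset_Icc_self ht)
    obtain ⟨q, hq, hb⟩ := hBk _ t (ω t) c hfun (hωM t (hpos t (Ico_subset_Icc_self ht))) hu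
    rw [transformedError_eq_of_upper h heq] at hb
    have h1 := (abs_le.1 hb).2
    have h2 := mul_le_mul_of_nonneg_right hq hΛ
    have h3 := mul_nonneg hκ0.le (hexp0 t)
    simp only [hR]
    linarith

lemma exists_tightening {a A Λ : ℝ} (ha : 0 < a) (hA : 0 < A) :
    ∃ κ, 0 < κ ∧ κ < 1 ∧ κ * A ≤ a ∧ 0 ≤ Real.log ((1 - κ) / κ) ∧
      Λ < Real.log ((1 - κ) / κ) := by
  -- The first bound on κ fits the initial margin; the second gives (1 - κ)/κ ≥ 1 + exp Λ.
  have hb : 0 < 1 / (2 + Real.exp Λ) := by positivity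
  have hκ : 0 < min (a / A) (1 / (2 + Real.exp Λ)) := lt_min (by positivity) hb
  set κ := min (a / A) (1 / (2 + Real.exp Λ)) with hκdef
  have h1 : κ * (2 + Real.exp Λ) ≤ 1 := by
    rw [← le_div_iff₀ (by positivity)]; exact min_le_right _ _
  have hratio : 1 + Real.exp Λ ≤ (1 - κ) / κ := by
    rw [le_div_iff₀ hκ]; linarith
  have hexp := Real.exp_pos Λ
  refine ⟨κ, hκ, by nlinarith, ?_, Real.log_nonneg (by linarith), ?_⟩
  · rw [← le_div_iff₀ hA]; exact min_le_left _ _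
  · rw [Real.lt_log_iff_exp_lt (by linarith)]; linarith

/-- Inside the tightened funnel and up to a fixed time, sampling intervals have a positive
minimal length. -/
lemma RegularFunnel.exists_step_lower_bound (h : RegularFunnel η ψ p) (hf : Continuous f)
    (hg : Continuous g) (hw : PiecewiseContinuous w) {M : ℝ} (hM : ∀ t, 0 ≤ t → ‖w t‖ ≤ M)
    {δu : ℝ} (hδu : 0 < δu) {κ : ℝ} (hκ : 0 < κ) (T : ℝ) :
    ∃ b, 0 < b ∧ ∀ (s τ σ : ℝ) (z : ℝ → Fin n → ℝ), s ≤ T → s ≤ τ → τ < σ →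
      InTightFunnel η ψ p κ (z s) s →
      IsTrajectory f g w (fun _ => controlLaw g η ψ p (z s) s) s σ z →
      IsGLB (triggerSet z (samplingRadius g η ψ p δu (z s) s) s σ) τ →
      (∀ t ∈ Icc s τ, InFunnel η ψ p (z t) t) → b ≤ τ - s := by
  have hKT := h.isCompact_tightFunnel hκ T
  have hKΩ : ∀ q ∈ {q : (Fin n → ℝ) × ℝ | InTightFunnel η ψ p κ q.1 q.2 ∧ q.2 ≤ T},
      InFunnel η ψ p q.1 q.2 := fun q hq => hq.1.inFunnel h hκ
  obtain ⟨d, ⟨hd0, hd1⟩, hd⟩ := h.exists_isSamplingRadius_of_isCompact hg hδu hKT hKΩ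
  obtain ⟨U, hU⟩ := hKT.exists_bound_of_continuousOn
    (f := fun q => controlLaw g η ψ p q.1 q.2) fun q hq =>
      (h.continuousAt_controlLaw hg (hKΩ q hq).2).continuousWithinAt
  obtain ⟨V, hV⟩ := ((h.isCompact_superlevel (p.ρmax - p.γ₀)).prod
    ((isCompact_closedBall (0 : Fin n → ℝ) M).prod
      (isCompact_closedBall (0 : Fin m → ℝ) U))).exists_bound_of_continuousOn
    (f := fun q => f q.1 + g q.1 *ᵥ q.2.2 + q.2.1)
    (((hf.comp continuous_fst).add ((hg.comp continuous_fst).matrix_mulVec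
      (continuous_snd.comp continuous_snd))).add
      (continuous_fst.comp continuous_snd)).continuousOn
  have hV1 : 0 < max V 1 := lt_max_of_lt_right one_pos
  -- The radius is at least d / 2. A time trigger needs that long; a distance trigger must cover d /
  -- 2 at speed at most `max V 1`.
  refine ⟨min (d / 2) (d / 2 / max V 1), by positivity, ?_⟩
  intro s τ σ z hsT hsτ hτσ hs hz hτ hΩ
  have hrad := half_le_samplingRadius hd0 hd1 (hd (z s, s) ⟨hs, hsT⟩)
  rcases trigger_of_isGLB_triggerSet hz.continuousOn hτ hsτ hτσ with htr | htr
  · refine (min_le_right _ _).trans ?_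
    rw [div_le_iff₀ hV1]
    refine hrad.trans (htr.trans ?_)
    choose! ω hω using hw.right_limit
    have hωM : ∀ t, 0 ≤ t → ‖ω t‖ ≤ M := fun t ht => by
      refine le_of_tendsto (hω t ht).norm ?_
      filter_upwards [self_mem_nhdsWithin] with u hu
      exact hM u (ht.trans (le_of_lt hu))
    rw [mul_comm]
    refine norm_image_sub_le_of_norm_deriv_right_le_segment
      (hz.continuousOn.mono fun t ht => ⟨ht.1, ht.2.trans_lt hτσ⟩)
      (fun t ht => hz.hasDerivWithinAt hf hg ⟨ht.1, ht.2.trans hτσ⟩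
        (hω t (hs.1.trans ht.1))) (fun t ht => ?_) τ ⟨hsτ, le_rfl⟩
    refine (hV (z t, ω t, controlLaw g η ψ p (z s) s) ⟨?_, ?_, ?_⟩).trans (le_max_left _ _)
    · exact (hΩ t (Ico_subset_Icc_self ht)).mem_superlevel h
    · exact mem_closedBall_zero_iff.2 (hωM t (hs.1.trans ht.1))
    · exact mem_closedBall_zero_iff.2 (hU (z s, s) ⟨hs, hsT⟩)
  · exact (min_le_left _ _).trans (hrad.trans htr)

/-! ### Assembling the closed loop -/

lemma exists_mem_Ico_of_tendsto {τ : ℕ → ℝ} (hτ0 : τ 0 = 0) (hτ : Tendsto τ atTop atTop) {t : ℝ}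
    (ht : 0 ≤ t) : ∃ i, t ∈ Ico (τ i) (τ (i + 1)) := by
  classical
  have hex : ∃ i, t < τ i := (hτ.eventually_gt_atTop t).exists
  obtain ⟨i, hi⟩ : ∃ i, Nat.find hex = i + 1 := Nat.exists_eq_succ_of_ne_zero fun h0 => by
    have := Nat.find_spec hex
    rw [h0, hτ0] at this
    exact this.not_ge ht
  refine ⟨i, not_lt.1 (Nat.find_min hex (by omega)), ?_⟩
  rw [← hi]
  exact Nat.find_spec hex

/-- Concatenation of trajectories with held inputs. -/
lemma exists_concatenation {τ σ : ℕ → ℝ} {Z : ℕ → ℝ → Fin n → ℝ} {c : ℕ → Fin m → ℝ}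
    (hτ0 : τ 0 = 0) (hmono : StrictMono τ) (hτ : Tendsto τ atTop atTop)
    (hσ : ∀ i, τ (i + 1) < σ i)
    (hZ : ∀ i, IsTrajectory f g w (fun _ => c i) (τ i) (σ i) (Z i))
    (hglue : ∀ i, Z (i + 1) (τ (i + 1)) = Z i (τ (i + 1))) :
    ∃ x uhat, (∀ i, EqOn x (Z i) (Icc (τ i) (τ (i + 1)))) ∧
      (∀ i, ∀ t ∈ Ico (τ i) (τ (i + 1)), uhat t = c i) ∧
      ∀ T, IsTrajectory f g w uhat 0 T x := by
  have hex : ∀ t, 0 ≤ t → ∃ i, t ∈ Ico (τ i) (τ (i + 1)) := fun t ht =>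
    exists_mem_Ico_of_tendsto hτ0 hτ ht
  choose! N hN using hex
  have hτnn : ∀ i, 0 ≤ τ i := fun i => hτ0 ▸ hmono.monotone i.zero_le
  have hNeq : ∀ i, ∀ t ∈ Ico (τ i) (τ (i + 1)), N t = i := fun i t ht => by
    have h := hN t ((hτnn i).trans ht.1)
    have h1 := hmono.lt_iff_lt.1 (h.1.trans_lt ht.2)
    have h2 := hmono.lt_iff_lt.1 (ht.1.trans_lt h.2)
    omega
  have hx : ∀ i, EqOn (fun t => Z (N t) t) (Z i) (Icc (τ i) (τ (i + 1))) := fun i t ht => by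
    rcases ht.2.lt_or_eq with hlt | rfl
    · simp only [hNeq i t ⟨ht.1, hlt⟩]
    · simp only [hNeq (i + 1) _ ⟨le_rfl, hmono (i + 1).lt_succ_self⟩, hglue]
  have hu : ∀ i, ∀ t ∈ Ico (τ i) (τ (i + 1)), c (N t) = c i := fun i t ht => by
    rw [hNeq i t ht]
  refine ⟨fun t => Z (N t) t, fun t => c (N t), hx, hu, fun T => ?_⟩
  set x : ℝ → Fin n → ℝ := fun t => Z (N t) t with hxdef
  set F : ℝ → Fin n → ℝ := fun t => f (x t) + g (x t) *ᵥ c (N t) + w t with hF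
  have key : ∀ i, ∀ t ∈ Icc 0 (τ i),
      IntervalIntegrable F volume 0 t ∧ x t = x 0 + ∫ t' in (0 : ℝ)..t, F t' := by
    intro i
    induction i with
    | zero =>
      intro t ht
      rw [hτ0, Icc_self, mem_singleton_iff] at ht
      simp [ht]
    | succ i ih =>
      intro t ht
      rcases le_or_gt t (τ i) with hle | hlt
      · exact ih t ⟨ht.1, hle⟩
      obtain ⟨hint, heq⟩ := ih (τ i) ⟨hτnn i, le_rfl⟩
      have hmem : t ∈ Ico (τ i) (σ i) := ⟨hlt.le, ht.2.trans_lt (hσ i)⟩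
      -- The held input may jump at the right endpoint, so the integrands are compared on the open
      -- interval only.
      have hFeq : EqOn (fun t' => f (Z i t') + g (Z i t') *ᵥ c i + w t') F (uIoo (τ i) t) := by
        intro u hu'
        rw [uIoo_of_le hlt.le] at hu'
        have h1 := hx i ⟨hu'.1.le, hu'.2.le.trans ht.2⟩
        have h2 := hu i u ⟨hu'.1.le, hu'.2.trans_le ht.2⟩
        simp only [hF, h2, hxdef] at h1 ⊢
        rw [h1]
      have hint' := ((hZ i).integrable t hmem).congr_uIoo hFeq
      refine ⟨hint.trans hint', ?_⟩
      rw [← intervalIntegral.integral_add_adjacent_intervals hint hint', ← add_assoc, ← heq,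
        ← intervalIntegral.integral_congr_uIoo hFeq]
      have h3 := (hZ i).eq_integral t hmem
      rw [← hx i ⟨hlt.le, ht.2⟩, ← hx i ⟨le_rfl, (hmono i.lt_succ_self).le⟩] at h3
      exact h3
  obtain ⟨i, hi⟩ := (hτ.eventually_ge_atTop T).exists
  have hsub : Ico 0 T ⊆ Icc 0 (τ i) := fun t ht => ⟨ht.1, ht.2.le.trans hi⟩
  refine ⟨?_, fun t ht => (key i t (hsub ht)).1, fun t ht => (key i t (hsub ht)).2⟩
  -- Continuity across the sampling times is read off the integral equation.
  have hcont := intervalIntegral.continuousOn_primitive_interval'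
    (key i (τ i) ⟨hτnn i, le_rfl⟩).1 left_mem_uIcc
  rw [uIcc_of_le (hτnn i)] at hcont
  exact ((continuousOn_const.add hcont).congr fun t ht => (key i t ht).2).mono hsub

/-- Between two samples the trajectory stays where the held input is close to the control law. -/
lemma RegularFunnel.inFunnel_of_isGLB (h : RegularFunnel η ψ p) (hg : Continuous g) {δu : ℝ}
    (hδu : 0 < δu) {s τ σ : ℝ} {z : ℝ → Fin n → ℝ} (hτσ : τ < σ)
    (hz : ContinuousOn z (Ico s σ)) (hs : InFunnel η ψ p (z s) s)
    (hτ : IsGLB (triggerSet z (samplingRadius g η ψ p δu (z s) s) s σ) τ) {t : ℝ}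
    (ht : t ∈ Icc s τ) : InFunnel η ψ p (z t) t ∧
      ‖controlLaw g η ψ p (z t) t - controlLaw g η ψ p (z s) s‖ ≤ δu := by
  obtain ⟨h1, h2⟩ := le_of_isGLB_triggerSet (samplingRadius_pos _ _).le hz hτ hτσ ht
  exact h.isSamplingRadius_samplingRadius hg hδu hs _ _ h1 ht.1 (by linarith)

lemma IsEventTriggeredSolution.inFunnel (h : RegularFunnel η ψ p) (hg : Continuous g) {δu : ℝ}
    (hδu : 0 < δu) {x₀ : Fin n → ℝ} (hx₀ : InFunnel η ψ p x₀ 0) {x : ℝ → Fin n → ℝ} {τ : ℕ → ℝ}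
    {uhat : ℝ → Fin m → ℝ}
    (hx : IsEventTriggeredSolution f g w (controlLaw g η ψ p) (samplingRadius g η ψ p δu) x₀
      x τ uhat) {t : ℝ} (ht : 0 ≤ t) : InFunnel η ψ p (x t) t := by
  have step : ∀ i, InFunnel η ψ p (x (τ i)) (τ i) →
      ∀ t ∈ Icc (τ i) (τ (i + 1)), InFunnel η ψ p (x t) t := fun i hi t ht => by
    obtain ⟨σ, z, hσ, hz, hxz, hGLB⟩ := hx.τ_succ i
    have hle := (hx.τ_strictMono i.lt_succ_self).le
    have h0 := hxz ⟨le_rfl, hle⟩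
    rw [h0] at hi hGLB
    rw [hxz ht]
    exact (h.inFunnel_of_isGLB hg hδu hσ hz.continuousOn hi hGLB ht).1
  have all : ∀ i, InFunnel η ψ p (x (τ i)) (τ i) := fun i => by
    induction i with
    | zero => rwa [hx.τ_zero, hx.initial]
    | succ i ih => exact step i ih _ ⟨(hx.τ_strictMono i.lt_succ_self).le, le_rfl⟩
  obtain ⟨i, hi⟩ := exists_mem_Ico_of_tendsto hx.τ_zero hx.τ_tendsto ht
  exact step i (all i) t (Ico_subset_Icc_self hi)

/-- The event-triggered closed loop has a solution without Zeno behaviour. -/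
lemma RegularFunnel.exists_isEventTriggeredSolution (h : RegularFunnel η ψ p)
    (hf : LocallyLipschitz f) (hg : ∀ i j, LocallyLipschitz (fun y => g y i j))
    (hgpos : ∃ lam : ℝ, 0 < lam ∧ ∀ y z : Fin n → ℝ, lam * (z ⬝ᵥ z) ≤ z ⬝ᵥ ((g y * (g y)ᵀ) *ᵥ z))
    (hw : PiecewiseContinuous w) {M : ℝ} (hM : ∀ t, 0 ≤ t → ‖w t‖ ≤ M)
    {δu : ℝ} (hδu : 0 < δu) {x₀ : Fin n → ℝ} (hx₀ : InFunnel η ψ p x₀ 0) :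
    ∃ x τ uhat, IsEventTriggeredSolution f g w (controlLaw g η ψ p)
      (samplingRadius g η ψ p δu) x₀ x τ uhat := by
  have hgc := continuous_of_locallyLipschitz_entries hg
  obtain ⟨B, k, hk, hBk⟩ := h.exists_dissipation_bounds hf.continuous hgc hgpos M δu
  have hfun := (mem_funnel_iff h).1 hx₀.2
  rw [p.gamma_zero] at hfun
  have hγ₀ : 0 < p.γ₀ := h.γinf_pos.trans_le h.γinf_le
  -- Here a is the distance of ρ^ψ(x₀) to the nearer wall at time 0, and Λ is the value at which the
  -- inward drift outweighs B and the wall speed. The same κ serves for all times.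
  obtain ⟨κ, hκ0, hκ1, hκa, hΛ0, hΛ⟩ := exists_tightening
    (a := min (p.ρmax - ψ.rhoReal η x₀) (ψ.rhoReal η x₀ - (p.ρmax - p.γ₀))) (A := p.γ₀)
    (Λ := (B + (p.γ₀ - p.γinf) * p.l) / k) (lt_min (by linarith) (by linarith)) hγ₀
  rw [div_lt_iff₀' hk] at hΛ
  have htight₀ : InTightFunnel η ψ p κ x₀ 0 := by
    have h1 := hκa.trans (min_le_left _ _)
    have h2 := hκa.trans (min_le_right _ _)
    refine ⟨le_rfl, ?_, ?_⟩ <;> rw [p.gamma_zero] <;> linarith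
  have hstep : ∀ q : (Fin n → ℝ) × ℝ, 0 ≤ q.2 → ∃ (τ σ : ℝ) (z : ℝ → Fin n → ℝ), q.2 < τ ∧
      τ < σ ∧ z q.2 = q.1 ∧
      IsTrajectory f g w (fun _ => controlLaw g η ψ p q.1 q.2) q.2 σ z ∧
      IsGLB (triggerSet z (samplingRadius g η ψ p δu q.1 q.2) q.2 σ) τ := fun q hq =>
    exists_trigger hf hg hw hM hq q.1 _ (samplingRadius_pos _ _) (samplingRadius_le_one _ _)
  choose! next horizon traj hnext hhor hinit htraj hglb using hstep
  set Q : ℕ → (Fin n → ℝ) × ℝ := fun i => (fun q => (traj q (next q), next q))^[i] (x₀, 0) with hQ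
  have hQ0 : Q 0 = (x₀, 0) := rfl
  have hQs : ∀ i, Q (i + 1) = (traj (Q i) (next (Q i)), next (Q i)) := fun i =>
    Function.iterate_succ_apply' _ i _
  have hinv : ∀ q : (Fin n → ℝ) × ℝ, InTightFunnel η ψ p κ q.1 q.2 → ∀ t ∈ Icc q.2 (next q),
      InFunnel η ψ p (traj q t) t ∧
        ‖controlLaw g η ψ p (traj q t) t - controlLaw g η ψ p q.1 q.2‖ ≤ δu := by
    intro q hq t ht
    have h1 := h.inFunnel_of_isGLB (z := traj q) hgc hδu (hhor q hq.1)
      (htraj q hq.1).continuousOn (by rw [hinit q hq.1]; exact hq.inFunnel h hκ0)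
      (by rw [hinit q hq.1]; exact hglb q hq.1) ht
    rwa [hinit q hq.1] at h1
  have htight : ∀ i, InTightFunnel η ψ p κ (Q i).1 (Q i).2 := fun i => by
    induction i with
    | zero => exact htight₀
    | succ i ih =>
      rw [hQs]
      exact InTightFunnel.of_isTrajectory h hf.continuous hgc hw hM hBk hκ0 hκ1 hΛ0 hΛ
        (hhor _ ih.1) (htraj _ ih.1) (by rwa [hinit _ ih.1]) (hinv _ ih)
        ⟨(hnext _ ih.1).le, le_rfl⟩
  have hτs : ∀ i, (Q (i + 1)).2 = next (Q i) := fun i => by rw [hQs]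
  have hxs : ∀ i, (Q (i + 1)).1 = traj (Q i) (next (Q i)) := fun i => by rw [hQs]
  have hmono : StrictMono fun i => (Q i).2 := strictMono_nat_of_lt_succ fun i => by
    rw [hτs]; exact hnext _ (htight i).1
  have htend : Tendsto (fun i => (Q i).2) atTop atTop := by
    rcases tendsto_atTop_of_monotone hmono.monotone with hinf | ⟨T, hT⟩
    · exact hinf
    -- If the sampling times converged to T, all steps would be at least the b belonging to T, yet
    -- consecutive differences tend to 0.
    exfalso
    obtain ⟨b, hb, hbstep⟩ := h.exists_step_lower_bound hf.continuous hgc hw hM hδu hκ0 T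
    have hle : ∀ i, b ≤ (Q (i + 1)).2 - (Q i).2 := fun i => by
      have hi := htight i
      rw [hτs]
      refine hbstep (Q i).2 _ (horizon (Q i)) (traj (Q i)) (hmono.monotone.ge_of_tendsto hT i)
        (hnext _ hi.1).le (hhor _ hi.1) ?_ ?_ ?_ fun t ht => (hinv _ hi t ht).1
      · rwa [hinit _ hi.1]
      · rw [hinit _ hi.1]; exact htraj _ hi.1
      · rw [hinit _ hi.1]; exact hglb _ hi.1
    have hdiff := ((tendsto_add_atTop_iff_nat 1).2 hT).sub hT
    rw [sub_self] at hdiff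
    exact (ge_of_tendsto' hdiff hle).not_gt hb
  obtain ⟨x, uhat, hx, hu, htr⟩ := exists_concatenation (f := f) (g := g) (w := w)
    (τ := fun i => (Q i).2) (σ := fun i => horizon (Q i)) (Z := fun i => traj (Q i))
    (c := fun i => controlLaw g η ψ p (Q i).1 (Q i).2) rfl hmono htend
    (fun i => by rw [hτs]; exact hhor _ (htight i).1) (fun i => htraj _ (htight i).1)
    (fun i => by rw [hinit _ (htight (i + 1)).1, hτs, hxs])
  have hxQ : ∀ i, x (Q i).2 = (Q i).1 := fun i => by
    rw [hx i ⟨le_rfl, (hmono i.lt_succ_self).le⟩, hinit _ (htight i).1]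
  refine ⟨x, fun i => (Q i).2, uhat, hxQ 0, htr, fun i t ht => ?_, rfl, fun i => ?_, hmono, htend⟩
  · rw [hu i t ht, hxQ]
  · refine ⟨horizon (Q i), traj (Q i), ?_, ?_, hx i, ?_⟩
    · rw [hτs]; exact hhor _ (htight i).1
    · rw [hxQ]; exact htraj _ (htight i).1
    · rw [hxQ, hτs]; exact hglb _ (htight i).1

lemma IsPPCChoice.inFunnel_zero {φ : TemporalFormula n} {x₀ : Fin n → ℝ}
    (hp : IsPPCChoice η φ x₀ p) (h : RegularFunnel η φ.inner p) : InFunnel η φ.inner p x₀ 0 := by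
  refine ⟨le_rfl, (mem_funnel_iff h).2 ⟨?_, ?_⟩⟩
  · rw [p.gamma_zero]
    linarith [hp.lt_γ₀]
  · have := (le_max_right _ _).trans_lt hp.lt_ρmax
    rwa [h.coe_rhoReal, EReal.coe_lt_coe_iff] at this

end ClosedLoop

theorem theorem1 {n m : ℕ}
    (g : (Fin n → ℝ) → Matrix (Fin n) (Fin m) ℝ)
    (hg : ∀ i j, LocallyLipschitz (fun y => g y i j))
    (hgpos : ∃ lam : ℝ, 0 < lam ∧
      ∀ y z : Fin n → ℝ, lam * (z ⬝ᵥ z) ≤ z ⬝ᵥ ((g y * (g y)ᵀ) *ᵥ z))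
    (η : ℝ) (hη : 0 < η)
    (φ : TemporalFormula n)
    (hconcave : ConcaveOn ℝ Set.univ (φ.inner.rhoReal η))
    (hwp : φ.inner.WellPosed η)
    (hopt : 0 < φ.inner.rhoOpt η)
    (x₀ : Fin n → ℝ)
    (p : PPCParams) (hp : IsPPCChoice η φ x₀ p)
    (δu : ℝ) (hδu : 0 < δu) :
    ∃ δ : (Fin n → ℝ) → ℝ → ℝ,
      (∀ y t, 0 < δ y t) ∧
      (∀ y t, InFunnel η φ.inner p y t →
        ∀ y' t', ‖y' - y‖ ≤ δ y t → t ≤ t' → t' ≤ t + δ y t →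
          InFunnel η φ.inner p y' t' ∧
          ‖controlLaw g η φ.inner p y' t' - controlLaw g η φ.inner p y t‖ ≤ δu) ∧
      ∀ (f : (Fin n → ℝ) → Fin n → ℝ) (_ : LocallyLipschitz f)
        (W : Set (Fin n → ℝ)) (_ : Bornology.IsBounded W)
        (w : ℝ → Fin n → ℝ) (_ : PiecewiseContinuous w) (_ : ∀ t, 0 ≤ t → w t ∈ W),
        (∃ x τ uhat,
          IsEventTriggeredSolution f g w (controlLaw g η φ.inner p) δ x₀ x τ uhat) ∧
        ∀ x τ uhat,
          IsEventTriggeredSolution f g w (controlLaw g η φ.inner p) δ x₀ x τ uhat →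
            0 < p.r ∧ (p.r : EReal) ≤ φ.rho η x 0 ∧ φ.rho η x 0 ≤ (p.ρmax : EReal) ∧
            φ.Sat x 0 := by
  have h := hp.regularFunnel hη hconcave hwp
  have hgc := continuous_of_locallyLipschitz_entries hg
  have hx₀ := hp.inFunnel_zero h
  refine ⟨samplingRadius g η φ.inner p δu, samplingRadius_pos,
    fun y t hy => h.isSamplingRadius_samplingRadius hgc hδu hy,
    fun f hf W hW w hw hwW => ?_⟩
  obtain ⟨M, hM⟩ := hW.exists_norm_le
  refine ⟨h.exists_isEventTriggeredSolution hf hg hgpos hw (fun t ht => hM _ (hwW t ht)) hδu hx₀,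
    fun x τ uhat hx => ⟨hp.r_pos, ?_⟩⟩
  exact robustness_of_inFunnel hη hp h fun t ht => hx.inFunnel h hgc hδu hx₀ ht
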